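/- \textbf{Theorem 3.} In \textsc{3-Partitioned-3-SAT} the input is a 3-CNF formula $\psi$ (a set of distinct clauses, each with at most three literals) over $N=3n$ variables, together with a partition of the variables into three sets $X^{\alpha},X^{\beta},X^{\gamma}$ of size $n$ each, such that no clause contains more than one variable from each of $X^{\alpha},X^{\beta},X^{\gamma}$; the question is whether $\psi$ is satisfiable. In \textsc{Metric Dimension} the input is a graph $G$ and a positive integer $k$; the question is whether there is a set $S\subseteq V(G)$ with $|S|\le k$ such that for any two distinct vertices $u,v\in V(G)$ there is $w\in S$ with $d(w,u)\ne d(w,v)$. Let $\mathrm{vc}(G)$ denote the size of a minimum vertex cover of $G$. There is an algorithm that, given an instance $\psi$ of \textsc{3-Partitioned-3-SAT} on $N\ge 1$ variables, runs in $2^{O(\sqrt N)}$ time and constructs an equivalent instance $(G,k)$ of \textsc{Metric Dimension} (that is, $\psi$ is satisfiable if and only if $(G,k)$ is a yes-instance) such that $\mathrm{vc}(G)+k=O(\sqrt N)$ and $|V(G)|=2^{O(\sqrt N)}$. -/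

import Mathlib

/-! ## Random access machines with unit-cost addition and subtraction

Programs act on finitely many registers (those that occur in the program), a random-access memory
whose cells hold natural numbers, and a write-only output tape.  The only arithmetic operations are
addition and truncated subtraction, so that the step count is polynomially related to the running
time of Turing machines. -/

namespace RAM

/-- Expressions: constants, registers, sums, truncated differences, and memory reads. -/
inductive Expr where
  | const (v : ℕ)
  | reg (r : ℕ)
  | add (a b : Expr)
  | sub (a b : Expr)
  | load (addr : Expr)

/-- Structured programs. -/
inductive Prog where
  | skip
  /-- put the value of `e` into register `r` -/
  | assign (r : ℕ) (e : Expr)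
  /-- put the value of `e` into the memory cell whose address is the value of `addr` -/
  | store (addr e : Expr)
  /-- append the value of `e` to the output -/
  | emit (e : Expr)
  | seq (p q : Prog)
  /-- run `p` if the value of `e` is nonzero, and `q` otherwise -/
  | branch (e : Expr) (p q : Prog)
  /-- run `p` again and again, as long as the value of `e` is nonzero -/
  | loop (e : Expr) (p : Prog)

/-- Configurations: contents of the registers and of the memory, and the output so far. -/
structure State where
  reg : ℕ → ℕ
  mem : ℕ → ℕ
  out : List ℕ

namespace Expr

/-- The value of an expression. -/
def eval : Expr → State → ℕ
  | const v, _ => v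
  | reg r, s => s.reg r
  | add a b, s => a.eval s + b.eval s
  | sub a b, s => a.eval s - b.eval s
  | load a, s => s.mem (a.eval s)

/-- The number of steps that the evaluation takes: one for each operation and each operand. -/
def cost : Expr → ℕ
  | const _ => 1
  | reg _ => 1
  | add a b => a.cost + b.cost + 1
  | sub a b => a.cost + b.cost + 1
  | load a => a.cost + 1

end Expr

/-- `Run p s s' t`: the program `p`, started in the configuration `s`, halts in the
configuration `s'` after exactly `t` steps. -/
inductive Run : Prog → State → State → ℕ → Prop where
  | skip (s : State) : Run .skip s s 1
  | assign (r : ℕ) (e : Expr) (s : State) :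
      Run (.assign r e) s { s with reg := Function.update s.reg r (e.eval s) } (e.cost + 1)
  | store (a e : Expr) (s : State) :
      Run (.store a e) s { s with mem := Function.update s.mem (a.eval s) (e.eval s) }
        (a.cost + e.cost + 1)
  | emit (e : Expr) (s : State) :
      Run (.emit e) s { s with out := s.out ++ [e.eval s] } (e.cost + 1)
  | seq {p q : Prog} {s s' s'' : State} {t t' : ℕ} :
      Run p s s' t → Run q s' s'' t' → Run (.seq p q) s s'' (t + t')
  | branch_pos {e : Expr} {p q : Prog} {s s' : State} {t : ℕ} :
      e.eval s ≠ 0 → Run p s s' t → Run (.branch e p q) s s' (e.cost + 1 + t)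
  | branch_neg {e : Expr} {p q : Prog} {s s' : State} {t : ℕ} :
      e.eval s = 0 → Run q s s' t → Run (.branch e p q) s s' (e.cost + 1 + t)
  | loop_done {e : Expr} {p : Prog} {s : State} :
      e.eval s = 0 → Run (.loop e p) s s (e.cost + 1)
  | loop_step {e : Expr} {p : Prog} {s s' s'' : State} {t t' : ℕ} :
      e.eval s ≠ 0 → Run p s s' t → Run (.loop e p) s' s'' t' →
        Run (.loop e p) s s'' (e.cost + 1 + t + t')

/-- The initial configuration on input `w`: the input is in the memory cells from address `0` on,
its length is in register `0`, everything else is zero, and the output is empty. -/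
def start (w : List ℕ) : State where
  reg := fun r => if r = 0 then w.length else 0
  mem := fun i => w.getD i 0
  out := []

/-- The program `p`, on input `w`, halts after exactly `t` steps with output `o`. -/
def OutputsIn (p : Prog) (w o : List ℕ) (t : ℕ) : Prop :=
  ∃ s, Run p (start w) s t ∧ s.out = o

end RAM

/-! ## 3-Partitioned-3-SAT -/

/-- Literals over the `3 * n` variables `x_{δ,i}`, with `δ : Fin 3` the part of the partition and
`i : Fin n` the index inside this part; `positive` is the sign of the literal. -/
structure Literal (n : ℕ) where
  part : Fin 3
  index : Fin n
  positive : Bool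

/-- Instances: a set of clauses, written as a list without repetition, over three disjoint sets of
`n` variables each. -/
structure PartitionedSAT where
  n : ℕ
  clauses : List (List (Literal n))
  /-- no clause is listed twice -/
  nodup : clauses.Nodup
  /-- a clause has at most three literals -/
  length_le : ∀ C ∈ clauses, C.length ≤ 3
  /-- a clause contains at most one variable from each of the three parts -/
  one_per_part : ∀ C ∈ clauses, ∀ l ∈ C, ∀ l' ∈ C, l.part = l'.part → l.index = l'.index

namespace PartitionedSAT

/-- The number `N` of variables. -/
def numVars (ψ : PartitionedSAT) : ℕ := 3 * ψ.n

/-- Some truth assignment makes at least one literal of every clause true. -/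
def Satisfiable (ψ : PartitionedSAT) : Prop :=
  ∃ π : Fin 3 → Fin ψ.n → Bool, ∀ C ∈ ψ.clauses, ∃ l ∈ C, π l.part l.index = l.positive

/-- The encoding of an instance: the size of the parts, the number of clauses, and then, for each
clause, its length followed by its literals, three numbers each (part, index, sign). -/
def encode (ψ : PartitionedSAT) : List ℕ :=
  ψ.n :: ψ.clauses.length :: ψ.clauses.flatMap fun C =>
    C.length :: C.flatMap fun l =>
      [(l.part : ℕ), (l.index : ℕ), if l.positive then 1 else 0]

end PartitionedSAT

/-! ## Metric Dimension -/

/-- Every two distinct vertices have different distances to some vertex of `S`. Vertices in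
different components have infinite distance. -/
def SimpleGraph.IsResolvingSet {V : Type*} (G : SimpleGraph V) (S : Set V) : Prop :=
  ∀ u v, u ≠ v → ∃ w ∈ S, G.edist w u ≠ G.edist w v

/-- Instances of Metric Dimension: a finite graph and a positive integer. -/
structure MetricDimensionInstance where
  numVerts : ℕ
  graph : SimpleGraph (Fin numVerts)
  k : ℕ
  k_pos : 0 < k

namespace MetricDimensionInstance

/-- The graph has a resolving set of size at most `k`. -/
def IsYes (I : MetricDimensionInstance) : Prop :=
  ∃ S : Finset (Fin I.numVerts), S.card ≤ I.k ∧ I.graph.IsResolvingSet (S : Set (Fin I.numVerts))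

open Classical in
/-- The encoding of an instance: `k`, the number of vertices, and the adjacency matrix, row by
row. -/
noncomputable def encode (I : MetricDimensionInstance) : List ℕ :=
  I.k :: I.numVerts :: (List.finRange I.numVerts).flatMap fun u =>
    (List.finRange I.numVerts).map fun v => if I.graph.Adj u v then 1 else 0

end MetricDimensionInstance

/-!
Arrange the variables of each part in a square with `b = O(√n)` rows and columns. Every row of every
part becomes a *bucket*, and an *assignment* of the bucket lists the values of the `b` variables of
its row, so that there are `2 ^ O(b)` assignments. The graph contains a pair of near-twins for each
of `O(b)` labels and for each bucket. The pair of a label is distinguished only by its own two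
vertices, and the pair of a bucket only by its own two vertices and by the assignments of the
bucket. A resolving set with as many vertices as there are labels and buckets therefore selects one
vertex per label, which is enough to recover the binary codes of all vertices up to near-twins, and
at most one assignment per bucket. What remains is a pair of near-twins for each clause, which has
to be distinguished by a selected assignment.

There are too many assignments and clauses for a small vertex cover to contain either, so they must
not be adjacent, and a clause learns about an assignment through `O(b)` *portals*: one for each
bucket, and one for each part, column and truth value. An assignment meets the portal of its bucket
and those of the values that it lists. A literal blocks the portal of the bucket of its variable,
and all the portals for columns of its part except the one for the column of its variable and the
value that makes the literal false. A clause blocks what its literals block. Since it contains at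
most one variable of each part, its literals do not interfere, and it blocks all the portals that an
assignment meets exactly if the assignment makes one of its literals true. The pair of the clause is
built so that precisely then it is distinguished. The vertices that are neither assignments nor
clauses form a vertex cover of size `O(b)`. Every entry of the adjacency matrix is computed from
numbers below `2 ^ O(b)` by arithmetic that takes time polynomial in these numbers.
-/

/-! ### Distances -/

section Distance

variable {V W : Type*} {G : SimpleGraph V} {H : SimpleGraph W} {u v w : V}

theorem edist_apply_le_of_hom (f : G →g H) (u v : V) : H.edist (f u) (f v) ≤ G.edist u v :=
  le_iInf fun p => by simpa using H.edist_le (p.map f)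

theorem edist_apply_of_iso (f : G ≃g H) (u v : V) : H.edist (f u) (f v) = G.edist u v :=
  le_antisymm (edist_apply_le_of_hom f.toHom u v)
    (by simpa using edist_apply_le_of_hom f.symm.toHom (f u) (f v))

theorem isResolvingSet_image_of_iso (f : G ≃g H) {S : Set V} (hS : G.IsResolvingSet S) :
    H.IsResolvingSet (f '' S) := by
  intro u v huv
  obtain ⟨w, hw, h⟩ := hS (f.symm u) (f.symm v) (f.symm.injective.ne huv)
  refine ⟨f w, ⟨w, hw, rfl⟩, ?_⟩
  simpa [← edist_apply_of_iso f] using h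

theorem exists_card_le_isResolvingSet_of_iso (f : G ≃g H) {k : ℕ}
    (h : ∃ S : Finset V, S.card ≤ k ∧ G.IsResolvingSet S) :
    ∃ S : Finset W, S.card ≤ k ∧ H.IsResolvingSet S := by
  obtain ⟨S, hk, hS⟩ := h
  exact ⟨S.map f.toEquiv.toEmbedding, by rwa [Finset.card_map],
    by simpa using isResolvingSet_image_of_iso f hS⟩

theorem edist_eq_of_twins (h : ∀ z, z ≠ u → z ≠ v → (G.Adj z u ↔ G.Adj z v))
    (hu : w ≠ u) (hv : w ≠ v) : G.edist w u = G.edist w v := by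
  classical
  have h' : ∀ z, z ≠ u → z ≠ v → (G.Adj u z ↔ G.Adj v z) := fun z hzu hzv => by
    simpa only [G.adj_comm] using h z hzu hzv
  let f : G ≃g G :=
    { toEquiv := Equiv.swap u v
      map_rel_iff' := fun {x y} => by
        simp only [Equiv.swap_apply_def]
        split_ifs <;> simp_all [G.adj_comm] }
  have hw : f w = w := Equiv.swap_apply_of_ne_of_ne hu hv
  have hfu : f u = v := Equiv.swap_apply_left u v
  rw [← edist_apply_of_iso f w u, hw, hfu]

theorem edist_eq_of_commonNeighbors (hu : w ≠ u) (hv : w ≠ v) (h : G.Adj w u ↔ G.Adj w v)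
    (hcu : ¬G.Adj w u → (G.commonNeighbors w u).Nonempty)
    (hcv : ¬G.Adj w v → (G.commonNeighbors w v).Nonempty) : G.edist w u = G.edist w v := by
  by_cases ha : G.Adj w u
  · rw [SimpleGraph.edist_eq_one_iff_adj.2 ha, SimpleGraph.edist_eq_one_iff_adj.2 (h.1 ha)]
  · have hb := mt h.2 ha
    rw [SimpleGraph.edist_eq_two_iff.2 ⟨hu, ha, hcu ha⟩,
      SimpleGraph.edist_eq_two_iff.2 ⟨hv, hb, hcv hb⟩]

end Distance

/-! ### The gadget graph -/

/-- The vertices of the gadget graph over labels `Λ`, portals `P`, assignments `Q`, clauses `R` and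
buckets `B`. The vertices that carry a Boolean come in pairs of near-twins. -/
inductive Gadget.Vertex (Λ P Q R B : Type*)
  | forced (a : Λ) (copy : Bool)
  | portal (p : P)
  | assignment (q : Q)
  | clause (r : R) (copy : Bool)
  | bucket (g : B) (copy : Bool)
  | hub

/-- The data from which the gadget graph is built: every portal, assignment, clause and bucket has a
code, which is a set of labels; every assignment belongs to a bucket and meets some portals; and
every clause blocks some portals. -/
structure Gadget (Λ P Q R B : Type*) where
  portalCode : P → Set Λ
  assignmentCode : Q → Set Λ
  clauseCode : R → Set Λ
  bucketCode : B → Set Λ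
  bucketOf : Q → B
  Meets : P → Q → Prop
  Blocks : R → P → Prop

namespace Gadget

open Vertex

variable {Λ P Q R B : Type*}

/-- The other vertex of the pair of near-twins; a vertex that is not in a pair is its own twin. -/
def Vertex.twin : Vertex Λ P Q R B → Vertex Λ P Q R B
  | forced a c => forced a !c
  | clause r c => clause r !c
  | bucket g c => bucket g !c
  | v => v

variable (X : Gadget Λ P Q R B)

/-- The labels whose two forced vertices are adjacent to the given vertex. -/
def code : Vertex Λ P Q R B → Set Λ
  | forced a _ => {a}
  | portal p => X.portalCode p
  | assignment q => X.assignmentCode q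
  | clause r _ => X.clauseCode r
  | bucket g _ => X.bucketCode g
  | hub => Set.univ

/-- The adjacency of the gadget graph, with each edge listed in at least one of its two
directions. -/
def Rel : Vertex Λ P Q R B → Vertex Λ P Q R B → Prop
  | forced a _, v => a ∈ X.code v
  | portal p, assignment q => X.Meets p q
  | portal p, clause r c => c = true ∨ ¬X.Blocks r p
  | bucket g c, assignment q => c = false ∧ X.bucketOf q = g
  | hub, assignment _ => False
  | hub, _ => True
  | _, _ => False

/-- The gadget graph. Apart from the forced vertices, only an assignment can distinguish the two
vertices of a pair: the two buckets if it belongs there, and the two clauses if the clause blocks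
every portal that the assignment meets. -/
def graph : SimpleGraph (Vertex Λ P Q R B) := SimpleGraph.fromRel X.Rel

/-- The conditions under which small resolving sets of the gadget graph have to consist of one
forced vertex per label and one assignment per bucket. -/
structure Separating : Prop where
  eq_or_eq_twin : ∀ u v, X.code u = X.code v → v = u ∨ v = u.twin
  disjoint_code : ∀ q r, Disjoint (X.assignmentCode q) (X.clauseCode r)
  inter_code_nonempty : ∀ q g, (X.assignmentCode q ∩ X.bucketCode g).Nonempty
  exists_meets : ∀ q, ∃ p, X.Meets p q
  bucketOf_surjective : Function.Surjective X.bucketOf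

variable {X} {u v w : Vertex Λ P Q R B} {a : Λ} {q : Q} {r : R} {g : B} {c : Bool}

theorem adj_forced_iff (h : w ≠ forced a c) : X.graph.Adj (forced a c) w ↔ a ∈ X.code w := by
  cases w <;> simp [graph, Rel, code, h.symm, eq_comm]

theorem edist_forced_eq_one_iff (h : w ≠ forced a c) :
    X.graph.edist (forced a c) w = 1 ↔ a ∈ X.code w := by
  rw [SimpleGraph.edist_eq_one_iff_adj, adj_forced_iff h]

theorem adj_hub_iff : X.graph.Adj hub w ↔ w ≠ hub ∧ ∀ q, w ≠ assignment q := by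
  cases w <;> simp [graph, Rel, code]

theorem edist_forced_eq (h : w ≠ forced a false) (h' : w ≠ forced a true) :
    X.graph.edist w (forced a false) = X.graph.edist w (forced a true) := by
  refine edist_eq_of_twins (fun z hz hz' => ?_) h h'
  rw [X.graph.adj_comm, adj_forced_iff hz, X.graph.adj_comm, adj_forced_iff hz']

theorem edist_bucket_eq (hX : X.Separating) (hw : ∀ c, w ≠ bucket g c)
    (hq : ∀ q, w = assignment q → X.bucketOf q ≠ g) :
    X.graph.edist w (bucket g false) = X.graph.edist w (bucket g true) := by
  have common : ∀ c, ¬X.graph.Adj w (bucket g c) →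
      (X.graph.commonNeighbors w (bucket g c)).Nonempty := by
    intro c hc
    by_cases hwq : ∃ q, w = assignment q
    · obtain ⟨q, rfl⟩ := hwq
      obtain ⟨a, haq, hag⟩ := hX.inter_code_nonempty q g
      exact ⟨forced a false, ((adj_forced_iff (by simp)).2 haq).symm,
        ((adj_forced_iff (by simp)).2 hag).symm⟩
    · have hhub : w ≠ hub := by
        rintro rfl
        exact hc (adj_hub_iff.2 (by simp))
      exact ⟨hub, (adj_hub_iff.2 ⟨hhub, by simpa using hwq⟩).symm,
        (adj_hub_iff.2 (by simp)).symm⟩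
  refine edist_eq_of_commonNeighbors (hw _) (hw _) ?_ (common _) (common _)
  cases w <;> simp_all [graph, Rel, code]

theorem edist_clause_eq (h : (∃ a c, w = forced a c) ∨ ∃ g c, w = bucket g c) :
    X.graph.edist w (clause r false) = X.graph.edist w (clause r true) := by
  have common : ∀ c, (X.graph.commonNeighbors w (clause r c)).Nonempty := fun c =>
    ⟨hub, (adj_hub_iff.2 (by aesop)).symm, (adj_hub_iff.2 (by simp)).symm⟩
  refine edist_eq_of_commonNeighbors ?_ ?_ ?_ (fun _ => common _) fun _ => common _ <;>
    rcases h with ⟨a, c, rfl⟩ | ⟨g, c, rfl⟩ <;> simp [graph, Rel, code]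

theorem edist_assignment_clause_eq_two_iff (hX : X.Separating) :
    X.graph.edist (assignment q) (clause r c) = 2 ↔
      ∃ p, X.Meets p q ∧ (c = true ∨ ¬X.Blocks r p) := by
  rw [SimpleGraph.edist_eq_two_iff]
  constructor
  · rintro ⟨-, -, z, hzq, hzr⟩
    rw [SimpleGraph.mem_neighborSet] at hzq hzr
    cases z with
    | forced a c' =>
      have haq := (adj_forced_iff (by simp)).1 hzq.symm
      have har := (adj_forced_iff (by simp)).1 hzr.symm
      exact (Set.disjoint_left.1 (hX.disjoint_code q r) haq har).elim
    | portal p =>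
      exact ⟨p, by simpa [graph, Rel, code] using hzq, by simpa [graph, Rel, code] using hzr⟩
    | _ => simp [graph, Rel] at hzq hzr
  · rintro ⟨p, hpq, hpr⟩
    refine ⟨by simp, by simp [graph, Rel], portal p, ?_, ?_⟩ <;>
      simpa [graph, Rel, code]

theorem edist_assignment_clause_ne_iff (hX : X.Separating) :
    X.graph.edist (assignment q) (clause r false) ≠ X.graph.edist (assignment q) (clause r true) ↔
      ∀ p, X.Meets p q → X.Blocks r p := by
  obtain ⟨p, hp⟩ := hX.exists_meets q
  rw [(edist_assignment_clause_eq_two_iff (c := true) hX).2 ⟨p, hp, .inl rfl⟩, ne_eq,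
    edist_assignment_clause_eq_two_iff hX]
  simp

theorem edist_assignment_bucket_ne (h : X.bucketOf q = g) :
    X.graph.edist (assignment q) (bucket g false) ≠
      X.graph.edist (assignment q) (bucket g true) := by
  have hadj : X.graph.Adj (assignment q) (bucket g false) := by simp [graph, Rel, h]
  rw [SimpleGraph.edist_eq_one_iff_adj.2 hadj, ne_comm, ne_eq, SimpleGraph.edist_eq_one_iff_adj]
  simp [graph, Rel]

/-- The pair of near-twins that the vertex distinguishes regardless of the portals: a forced vertex
its own pair, a bucket its own pair, and an assignment the pair of its bucket. -/
def slot (X : Gadget Λ P Q R B) : Vertex Λ P Q R B → Option (Λ ⊕ B)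
  | forced a _ => some (.inl a)
  | bucket g _ => some (.inr g)
  | assignment q => some (.inr (X.bucketOf q))
  | _ => none

theorem exists_mem_slot_eq (hX : X.Separating) {S : Set (Vertex Λ P Q R B)}
    (hS : X.graph.IsResolvingSet S) (i : Λ ⊕ B) : ∃ w ∈ S, X.slot w = some i := by
  cases i with
  | inl a =>
    obtain ⟨w, hwS, hw⟩ := hS (forced a false) (forced a true) (by simp)
    contrapose! hw
    have hwa : ∀ c, w ≠ forced a c := fun c h => hw w hwS (by rw [h, slot])
    exact edist_forced_eq (hwa _) (hwa _)
  | inr g =>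
    obtain ⟨w, hwS, hw⟩ := hS (bucket g false) (bucket g true) (by simp)
    contrapose! hw
    refine edist_bucket_eq hX (fun c h => hw w hwS (by rw [h, slot])) fun q h hq => ?_
    exact hw w hwS (by rw [h, slot, hq])

theorem eq_of_slot_eq [Fintype Λ] [Fintype B] (hX : X.Separating)
    {S : Finset (Vertex Λ P Q R B)} (hS : X.graph.IsResolvingSet (S : Set (Vertex Λ P Q R B)))
    (hcard : S.card ≤ Fintype.card Λ + Fintype.card B) (hu : u ∈ S) :
    ∃ i, X.slot u = some i ∧ ∀ v ∈ S, X.slot v = some i → v = u := by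
  classical
  choose w hwS hw using exists_mem_slot_eq hX hS
  have hinj : Function.Injective w := fun i j h => Option.some_injective _ (by rw [← hw, ← hw, h])
  have himage : Finset.univ.image w = S := by
    refine Finset.eq_of_subset_of_card_le ?_ ?_
    · exact Finset.image_subset_iff.2 fun i _ => hwS i
    · simpa [Finset.card_image_of_injective _ hinj] using hcard
  have hmem : ∀ v ∈ S, ∃ i, w i = v := fun v hv => by
    simpa only [← himage, Finset.mem_image, Finset.mem_univ, true_and] using hv
  obtain ⟨i, rfl⟩ := hmem u hu
  refine ⟨i, hw i, fun v hv hvi => ?_⟩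
  obtain ⟨j, rfl⟩ := hmem v hv
  rw [Option.some_injective _ ((hw j).symm.trans hvi)]

/-- Every bucket is assigned one of its assignments, in such a way that every clause blocks all the
portals met by one of them. -/
def IsSolution (X : Gadget Λ P Q R B) (σ : B → Q) : Prop :=
  (∀ g, X.bucketOf (σ g) = g) ∧ ∀ r, ∃ g, ∀ p, X.Meets p (σ g) → X.Blocks r p

theorem exists_isSolution_of_isResolvingSet [Fintype Λ] [Fintype B] (hX : X.Separating)
    {S : Finset (Vertex Λ P Q R B)} (hS : X.graph.IsResolvingSet (S : Set (Vertex Λ P Q R B)))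
    (hcard : S.card ≤ Fintype.card Λ + Fintype.card B) : ∃ σ, X.IsSolution σ := by
  have choice : ∀ g, ∃ q, X.bucketOf q = g ∧
      ∀ q', X.bucketOf q' = g → assignment q' ∈ S → q' = q := by
    intro g
    by_cases h : ∃ q, X.bucketOf q = g ∧ assignment q ∈ S
    · obtain ⟨q, hq, hqS⟩ := h
      obtain ⟨i, hi, huniq⟩ := eq_of_slot_eq hX hS hcard hqS
      refine ⟨q, hq, fun q' hq' hqS' => ?_⟩
      simpa using huniq _ hqS' (by rw [← hi, slot, slot, hq, hq'])
    · obtain ⟨q, hq⟩ := hX.bucketOf_surjective g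
      exact ⟨q, hq, fun q' hq' hqS' => (h ⟨q', hq', hqS'⟩).elim⟩
  choose σ hσ huniq using choice
  refine ⟨σ, hσ, fun r => ?_⟩
  obtain ⟨w, hwS, hw⟩ := hS (clause r false) (clause r true) (by simp)
  obtain ⟨i, hi, -⟩ := eq_of_slot_eq hX hS hcard hwS
  cases w with
  | assignment q =>
    refine ⟨X.bucketOf q, ?_⟩
    rw [← huniq _ q rfl hwS]
    exact (edist_assignment_clause_ne_iff hX).1 hw
  | forced a c => exact (hw (edist_clause_eq (.inl ⟨a, c, rfl⟩))).elim
  | bucket g c => exact (hw (edist_clause_eq (.inr ⟨g, c, rfl⟩))).elim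
  | _ => simp [slot] at hi

/-- The vertices that a solution selects. -/
def chosen (σ : B → Q) : Λ ⊕ B → Vertex Λ P Q R B :=
  Sum.elim (forced · false) (assignment ∘ σ)

theorem exists_chosen_edist_twin_ne (hX : X.Separating) {σ : B → Q} (hσ : X.IsSolution σ)
    (hu : u ≠ u.twin) :
    ∃ i, X.graph.edist (chosen σ i) u ≠ X.graph.edist (chosen σ i) u.twin := by
  cases u with
  | forced a c =>
    refine ⟨.inl a, fun h => ?_⟩
    cases c <;> simp [chosen, twin, eq_comm (a := (0 : ℕ∞))] at h
  | clause r c =>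
    obtain ⟨g, hg⟩ := hσ.2 r
    have h := (edist_assignment_clause_ne_iff hX).2 hg
    cases c
    exacts [⟨.inr g, h⟩, ⟨.inr g, h.symm⟩]
  | bucket g c =>
    have h := edist_assignment_bucket_ne (hσ.1 g)
    cases c
    exacts [⟨.inr g, h⟩, ⟨.inr g, h.symm⟩]
  | _ => exact (hu rfl).elim

theorem isResolvingSet_range_chosen (hX : X.Separating) {σ : B → Q} (hσ : X.IsSolution σ) :
    X.graph.IsResolvingSet (Set.range (chosen σ)) := by
  intro u v huv
  rw [Set.exists_range_iff]
  by_cases hcode : X.code u = X.code v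
  · obtain rfl : v = u.twin := (hX.eq_or_eq_twin u v hcode).resolve_left huv.symm
    exact exists_chosen_edist_twin_ne hX hσ huv
  · simp only [Set.ext_iff, not_forall] at hcode
    obtain ⟨a, ha⟩ := hcode
    refine ⟨.inl a, fun h => ?_⟩
    change X.graph.edist (forced a false) u = X.graph.edist (forced a false) v at h
    rcases eq_or_ne u (forced a false) with rfl | hu
    · exact huv (SimpleGraph.edist_eq_zero_iff.1 (h.symm.trans SimpleGraph.edist_self))
    rcases eq_or_ne v (forced a false) with rfl | hv
    · exact huv (SimpleGraph.edist_eq_zero_iff.1 (h.trans SimpleGraph.edist_self)).symm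
    rw [← edist_forced_eq_one_iff hu, ← edist_forced_eq_one_iff hv, h] at ha
    exact ha Iff.rfl

theorem exists_isResolvingSet_iff_exists_isSolution [Fintype Λ] [Fintype B] (hX : X.Separating) :
    (∃ S : Finset (Vertex Λ P Q R B), S.card ≤ Fintype.card Λ + Fintype.card B ∧
      X.graph.IsResolvingSet (S : Set (Vertex Λ P Q R B))) ↔ ∃ σ, X.IsSolution σ := by
  classical
  refine ⟨fun ⟨S, hcard, hS⟩ => exists_isSolution_of_isResolvingSet hX hS hcard,
    fun ⟨σ, hσ⟩ => ⟨Finset.univ.image (chosen σ), ?_, ?_⟩⟩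
  · simpa using Finset.card_image_le (s := Finset.univ) (f := chosen (Λ := Λ) (P := P) (R := R) σ)
  · simpa using isResolvingSet_range_chosen hX hσ

theorem vertexCoverNum_graph_le [Fintype Λ] [Fintype P] [Fintype B] (X : Gadget Λ P Q R B) :
    X.graph.vertexCoverNum ≤
      (2 * Fintype.card Λ + Fintype.card P + 2 * Fintype.card B + 1 : ℕ) := by
  classical
  let f : (Λ × Bool) ⊕ P ⊕ (B × Bool) ⊕ Unit → Vertex Λ P Q R B :=
    Sum.elim (fun x => forced x.1 x.2) <| Sum.elim portal <|
      Sum.elim (fun x => bucket x.1 x.2) fun _ => hub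
  have hcover : X.graph.IsVertexCover (Finset.univ.image f : Finset (Vertex Λ P Q R B)) := by
    rintro u v ⟨-, h⟩
    cases u <;> cases v <;> simp_all [Rel, f]
  refine hcover.vertexCoverNum_le.trans ?_
  rw [Set.encard_coe_eq_coe_finsetCard, Nat.cast_le]
  refine Finset.card_image_le.trans ?_
  simp only [Finset.card_univ, Fintype.card_sum, Fintype.card_prod, Fintype.card_bool,
    Fintype.card_unit]
  omega

end Gadget

/-! ### Composing runs -/

namespace RAM

/-- The changes a subroutine may make: registers below `k` and the memory stay as they are, and `o`
is appended to the output. -/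
structure Frame (k : ℕ) (o : List ℕ) (s s' : State) : Prop where
  reg_eq : ∀ r < k, s'.reg r = s.reg r
  mem_eq : s'.mem = s.mem
  out_eq : s'.out = s.out ++ o

/-- The program `p`, started in `s`, puts `x` into register `k` within `T` steps, and changes
nothing else but the registers above `k`. -/
def Evaluates (p : Prog) (k : ℕ) (s : State) (x T : ℕ) : Prop :=
  ∃ s' t, Run p s s' t ∧ Frame k [] s s' ∧ s'.reg k = x ∧ t ≤ T

/-- The program `p`, started in `s`, outputs `o` within `T` steps, and changes nothing else but the
registers from `k` on. -/
def Emits (p : Prog) (k : ℕ) (s : State) (o : List ℕ) (T : ℕ) : Prop :=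
  ∃ s' t, Run p s s' t ∧ Frame k o s s' ∧ t ≤ T

section Runs

variable {j k x y T T' : ℕ} {o o' : List ℕ} {s s' s'' : State} {p q : Prog}

namespace Frame

theorem refl (k : ℕ) (s : State) : Frame k [] s s := ⟨fun _ _ => rfl, rfl, by simp⟩

theorem trans (h : Frame k o s s') (h' : Frame k o' s' s'') : Frame k (o ++ o') s s'' :=
  ⟨fun r hr => (h'.reg_eq r hr).trans (h.reg_eq r hr), h'.mem_eq.trans h.mem_eq, by
    rw [h'.out_eq, h.out_eq, List.append_assoc]⟩

theorem mono (h : Frame k o s s') (hjk : j ≤ k) : Frame j o s s' :=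
  ⟨fun r hr => h.reg_eq r (hr.trans_le hjk), h.mem_eq, h.out_eq⟩

theorem update (h : Frame k o s s') (hkj : k ≤ j) (x : ℕ) :
    Frame k o s { s' with reg := Function.update s'.reg j x } :=
  ⟨fun r hr => (Function.update_of_ne (hr.trans_le hkj).ne _ _).trans (h.reg_eq r hr),
    h.mem_eq, h.out_eq⟩

theorem emit (h : Frame k o s s') (x : ℕ) :
    Frame k (o ++ [x]) s { s' with out := s'.out ++ [x] } :=
  ⟨h.reg_eq, h.mem_eq, by rw [h.out_eq, List.append_assoc]⟩

end Frame

theorem evaluates_assign (k : ℕ) (e : Expr) (s : State) :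
    Evaluates (.assign k e) k s (e.eval s) (e.cost + 1) :=
  ⟨_, _, .assign k e s, (Frame.refl k s).update le_rfl _, Function.update_self .., le_rfl⟩

theorem Evaluates.mono (hp : Evaluates p k s x T) (hT : T ≤ T') : Evaluates p k s x T' := by
  obtain ⟨s', t, hr, hs, hx, ht⟩ := hp
  exact ⟨s', t, hr, hs, hx, ht.trans hT⟩

theorem Evaluates.bind (hkj : k ≤ j) (hp : Evaluates p j s x T)
    (hq : ∀ s', Frame j [] s s' → s'.reg j = x → Evaluates q k s' y T') :
    Evaluates (.seq p q) k s y (T + T') := by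
  obtain ⟨s', t, hr, hs, hx, ht⟩ := hp
  obtain ⟨s'', t', hr', hs', hy, ht'⟩ := hq s' hs hx
  exact ⟨s'', _, .seq hr hr', (hs.mono hkj).trans hs', hy, Nat.add_le_add ht ht'⟩

theorem Evaluates.branch (e : Expr) (hp : e.eval s ≠ 0 → Evaluates p k s x T)
    (hq : e.eval s = 0 → Evaluates q k s x T') :
    Evaluates (.branch e p q) k s x (e.cost + 1 + (T + T')) := by
  by_cases h : e.eval s = 0
  · obtain ⟨s', t, hr, hs, hx, ht⟩ := hq h
    exact ⟨s', _, .branch_neg h hr, hs, hx, by omega⟩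
  · obtain ⟨s', t, hr, hs, hx, ht⟩ := hp h
    exact ⟨s', _, .branch_pos h hr, hs, hx, by omega⟩

theorem Evaluates.bindEmits (hp : Evaluates p k s x T)
    (hq : ∀ s', Frame k [] s s' → s'.reg k = x → Emits q k s' o T') :
    Emits (.seq p q) k s o (T + T') := by
  obtain ⟨s', t, hr, hs, hx, ht⟩ := hp
  obtain ⟨s'', t', hr', hs', ht'⟩ := hq s' hs hx
  exact ⟨s'', _, .seq hr hr', hs.trans hs', Nat.add_le_add ht ht'⟩

theorem Emits.append (hp : Emits p k s o T) (hq : ∀ s', Frame k o s s' → Emits q k s' o' T') :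
    Emits (.seq p q) k s (o ++ o') (T + T') := by
  obtain ⟨s', t, hr, hs, ht⟩ := hp
  obtain ⟨s'', t', hr', hs', ht'⟩ := hq s' hs
  exact ⟨s'', _, .seq hr hr', hs.trans hs', Nat.add_le_add ht ht'⟩

theorem run_loop {e : Expr} (Inv : ℕ → State → Prop) {N : ℕ}
    (step : ∀ i < N, ∀ s, Inv i s → e.eval s ≠ 0 ∧ ∃ s' t, Run p s s' t ∧ Inv (i + 1) s' ∧ t ≤ T)
    (halt : ∀ s, Inv N s → e.eval s = 0) (hs : Inv 0 s) :
    ∃ s' t, Run (.loop e p) s s' t ∧ Inv N s' ∧ t ≤ N * (e.cost + 1 + T) + (e.cost + 1) := by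
  have remaining : ∀ j i, i + j = N → ∀ s, Inv i s →
      ∃ s' t, Run (.loop e p) s s' t ∧ Inv N s' ∧ t ≤ j * (e.cost + 1 + T) + (e.cost + 1) := by
    intro j
    induction j with
    | zero =>
      rintro i rfl s hs
      exact ⟨s, _, .loop_done (halt s hs), hs, by omega⟩
    | succ j ih =>
      intro i hi s hs
      obtain ⟨he, s', t, hr, hs', ht⟩ := step i (by omega) s hs
      obtain ⟨s'', t', hr', hs'', ht'⟩ := ih (i + 1) (by omega) s' hs'
      refine ⟨s'', _, .loop_step he hr hr', hs'', ?_⟩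
      rw [Nat.succ_mul]
      omega
  exact remaining N 0 (by omega) s hs

end Runs

/-! ### Polynomial time -/

/-- A class of inputs for subroutines: `arg` are the numbers that are passed in registers, `mem` is
the content of the memory, and `size` is the parameter in which running times are measured. -/
structure InputModel (ι σ : Type*) where
  arg : ι → σ → ℕ
  mem : ι → ℕ → ℕ
  size : ι → ℕ
  arg_le : ∀ a i, arg a i ≤ size a
  mem_le : ∀ a i, mem a i ≤ size a

namespace InputModel

variable {ι σ : Type*} (M : InputModel ι σ)

/-- The inputs that are extended by one more number, which is passed in the register `none`. -/
def push : InputModel (ι × ℕ) (Option σ) where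
  arg a i := i.elim a.2 (M.arg a.1)
  mem a := M.mem a.1
  size a := M.size a.1 + a.2
  arg_le
    | _, none => Nat.le_add_left _ _
    | a, some i => (M.arg_le a.1 i).trans (Nat.le_add_right _ _)
  mem_le a i := (M.mem_le a.1 i).trans (Nat.le_add_right _ _)

/-- The configuration `s` holds the input `a`, where `ρ` tells which registers are used. -/
structure Represents (ρ : σ → ℕ) (a : ι) (s : State) : Prop where
  reg_eq : ∀ i, s.reg (ρ i) = M.arg a i
  mem_eq : s.mem = M.mem a

/-- `T` is bounded by a polynomial in the size of the input. -/
def PolyBounded (T : ι → ℕ) : Prop := ∃ D, ∀ a, T a ≤ (M.size a + 2) ^ D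

/-- `f` is polynomially bounded and can be computed in polynomial time, in any register that lies
above those which hold the input. -/
structure PolyTime (f : ι → ℕ) : Prop where
  polyBounded : M.PolyBounded f
  exists_evaluates : ∀ (ρ : σ → ℕ) k, (∀ i, ρ i < k) → ∃ p T, M.PolyBounded T ∧
    ∀ a s, M.Represents ρ a s → Evaluates p k s (f a) (T a)

open Classical in
/-- `P` can be decided in polynomial time. -/
def PolyDecidable (P : ι → Prop) : Prop := M.PolyTime fun a => if P a then 1 else 0

/-- `l` can be output in polynomial time. -/
def PolyEmits (l : ι → List ℕ) : Prop :=
  ∀ (ρ : σ → ℕ) k, (∀ i, ρ i < k) → ∃ p T, M.PolyBounded T ∧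
    ∀ a s, M.Represents ρ a s → Emits p k s (l a) (T a)

variable {M} {ρ : σ → ℕ} {k : ℕ} {a : ι} {s s' : State}

theorem Represents.of_frame {o : List ℕ} (h : M.Represents ρ a s) (hρ : ∀ i, ρ i < k)
    (hs : Frame k o s s') : M.Represents ρ a s' :=
  ⟨fun i => (hs.reg_eq _ (hρ i)).trans (h.reg_eq i), hs.mem_eq.trans h.mem_eq⟩

theorem Represents.push {x : ℕ} (h : M.Represents ρ a s) (hx : s.reg k = x) :
    M.push.Represents (fun i => i.elim k ρ) (a, x) s :=
  ⟨fun | none => hx | some i => h.reg_eq i, h.mem_eq⟩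

theorem Represents.of_push {ρ : Option σ → ℕ} {a : ι × ℕ} (h : M.push.Represents ρ a s) :
    M.Represents (ρ ∘ some) a.1 s :=
  ⟨fun i => h.reg_eq (some i), h.mem_eq⟩

theorem elim_lt {j : ℕ} (hρ : ∀ i, ρ i < k) (hkj : k < j) (i : Option σ) : i.elim k ρ < j := by
  cases i with
  | none => exact hkj
  | some i => exact (hρ i).trans hkj

namespace PolyBounded

variable {S T : ι → ℕ}

theorem mono (hT : M.PolyBounded T) (h : ∀ a, S a ≤ T a) : M.PolyBounded S :=
  hT.imp fun _ hD a => (h a).trans (hD a)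

theorem const (c : ℕ) : M.PolyBounded fun _ => c :=
  ⟨c, fun a => Nat.lt_two_pow_self.le.trans (Nat.pow_le_pow_left (by omega) c)⟩

theorem size : M.PolyBounded M.size := ⟨1, fun a => by simp⟩

theorem mul (hS : M.PolyBounded S) (hT : M.PolyBounded T) :
    M.PolyBounded fun a => S a * T a := by
  obtain ⟨D, hD⟩ := hS
  obtain ⟨E, hE⟩ := hT
  exact ⟨D + E, fun a => (Nat.mul_le_mul (hD a) (hE a)).trans_eq (pow_add ..).symm⟩

theorem add (hS : M.PolyBounded S) (hT : M.PolyBounded T) :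
    M.PolyBounded fun a => S a + T a := by
  obtain ⟨D, hD⟩ := hS
  obtain ⟨E, hE⟩ := hT
  refine ((const 2).mul ⟨D + E, fun a => le_rfl⟩).mono fun a => ?_
  have hS' : (M.size a + 2) ^ D ≤ (M.size a + 2) ^ (D + E) :=
    Nat.pow_le_pow_right (by omega) (by omega)
  have hT' : (M.size a + 2) ^ E ≤ (M.size a + 2) ^ (D + E) :=
    Nat.pow_le_pow_right (by omega) (by omega)
  linarith [hD a, hE a]

theorem pow (hT : M.PolyBounded T) (n : ℕ) : M.PolyBounded fun a => T a ^ n := by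
  obtain ⟨D, hD⟩ := hT
  exact ⟨D * n, fun a => (Nat.pow_le_pow_left (hD a) n).trans_eq (pow_mul ..).symm⟩

theorem of_push {T : ι × ℕ → ℕ} (hT : M.push.PolyBounded T) {B : ι → ℕ} (hB : M.PolyBounded B) :
    ∃ T', M.PolyBounded T' ∧ ∀ a, ∀ x ≤ B a, T (a, x) ≤ T' a := by
  obtain ⟨D, hD⟩ := hT
  refine ⟨_, ((size.add hB).add (const 2)).pow D, fun a x hx => (hD (a, x)).trans ?_⟩
  exact Nat.pow_le_pow_left (Nat.add_le_add_right (Nat.add_le_add_left hx _) 2) D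

theorem lift (hT : M.PolyBounded T) : M.push.PolyBounded fun a => T a.1 :=
  hT.imp fun D hD a => (hD a.1).trans <| Nat.pow_le_pow_left
    (Nat.add_le_add_right (Nat.le_add_right (M.size a.1) a.2) 2) D

end PolyBounded

namespace PolyTime

variable {f g h : ι → ℕ} {P : ι → Prop}

theorem of_expr (E : (σ → ℕ) → Expr) (hf : M.PolyBounded f)
    (h : ∀ ρ a s, M.Represents ρ a s → (E ρ).eval s = f a) : M.PolyTime f :=
  ⟨hf, fun ρ k _ => ⟨.assign k (E ρ), fun _ => (E ρ).cost + 1, .const _, fun a s hs =>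
    h ρ a s hs ▸ evaluates_assign k (E ρ) s⟩⟩

theorem const (c : ℕ) : M.PolyTime fun _ => c :=
  of_expr (fun _ => .const c) (.const c) fun _ _ _ _ => rfl

theorem arg (i : σ) : M.PolyTime (M.arg · i) :=
  of_expr (fun ρ => .reg (ρ i)) (PolyBounded.size.mono (M.arg_le · i)) fun _ _ _ hs => hs.reg_eq i

theorem snd : M.push.PolyTime Prod.snd := arg (M := M.push) none

theorem lift (hf : M.PolyTime f) : M.push.PolyTime fun a => f a.1 := by
  refine ⟨hf.polyBounded.lift, fun ρ k hρ => ?_⟩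
  obtain ⟨p, T, hT, hp⟩ := hf.exists_evaluates (ρ ∘ some) k fun i => hρ (some i)
  exact ⟨p, fun a => T a.1, hT.lift, fun a s hs => hp a.1 s hs.of_push⟩

theorem bind {g : ι × ℕ → ℕ} (hg : M.push.PolyTime g) (hf : M.PolyTime f) :
    M.PolyTime fun a => g (a, f a) := by
  obtain ⟨G, hG, hGg⟩ := hg.polyBounded.of_push hf.polyBounded
  refine ⟨hG.mono fun a => hGg a _ le_rfl, fun ρ k hρ => ?_⟩
  obtain ⟨p, T, hT, hp⟩ := hf.exists_evaluates ρ k hρ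
  obtain ⟨q, U, hU, hq⟩ := hg.exists_evaluates _ (k + 1) (elim_lt hρ (Nat.lt_succ_self k))
  obtain ⟨U', hU', hUU'⟩ := hU.of_push hf.polyBounded
  refine ⟨.seq p (.seq q (.assign k (.reg (k + 1)))), _, hT.add (hU'.add (.const 2)),
    fun a s hs => (hp a s hs).bind le_rfl fun s₁ hs₁ hx => ?_⟩
  refine ((hq (a, f a) s₁ ((hs.of_frame hρ hs₁).push hx)).mono (hUU' a _ le_rfl)).bind
    (Nat.le_succ k) fun s₂ _ hy => ?_
  exact hy ▸ evaluates_assign k (.reg (k + 1)) s₂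

theorem load (hf : M.PolyTime f) : M.PolyTime fun a => M.mem a (f a) :=
  bind (g := fun b => M.mem b.1 b.2)
    (of_expr (fun ρ => .load (.reg (ρ none))) (PolyBounded.size.mono fun b => M.push.mem_le b b.2)
      fun _ b s hs => by rw [Expr.eval, Expr.eval, hs.mem_eq, hs.reg_eq none]; rfl) hf

theorem add (hf : M.PolyTime f) (hg : M.PolyTime g) : M.PolyTime fun a => f a + g a :=
  bind (bind (g := fun b => b.1.2 + b.2)
    (of_expr (fun ρ => .add (.reg (ρ (some none))) (.reg (ρ none)))
      (snd.lift.polyBounded.add snd.polyBounded)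
      fun _ _ _ hs => by rw [Expr.eval, Expr.eval, Expr.eval, hs.reg_eq, hs.reg_eq]; rfl)
    hg.lift) hf

theorem sub (hf : M.PolyTime f) (hg : M.PolyTime g) : M.PolyTime fun a => f a - g a :=
  bind (bind (g := fun b => b.1.2 - b.2)
    (of_expr (fun ρ => .sub (.reg (ρ (some none))) (.reg (ρ none)))
      (snd.lift.polyBounded.mono fun _ => Nat.sub_le _ _)
      fun _ _ _ hs => by rw [Expr.eval, Expr.eval, Expr.eval, hs.reg_eq, hs.reg_eq]; rfl)
    hg.lift) hf

open Classical in
theorem ite (hP : M.PolyDecidable P) (hf : M.PolyTime f) (hg : M.PolyTime g) :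
    M.PolyTime fun a => if P a then f a else g a := by
  refine ⟨(hf.polyBounded.add hg.polyBounded).mono fun a => ?_, fun ρ k hρ => ?_⟩
  · split_ifs
    exacts [Nat.le_add_right _ _, Nat.le_add_left _ _]
  obtain ⟨p, T, hT, hp⟩ := hf.exists_evaluates ρ k hρ
  obtain ⟨q, U, hU, hq⟩ := hg.exists_evaluates ρ k hρ
  obtain ⟨r, V, hV, hr⟩ := hP.exists_evaluates ρ k hρ
  refine ⟨.seq r (.branch (.reg k) p q), fun a => V a + (2 + (T a + U a)),
    hV.add ((PolyBounded.const 2).add (hT.add hU)), fun a s hs =>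
    (hr a s hs).bind le_rfl fun s₁ hs₁ hx => ?_⟩
  have hs' := hs.of_frame hρ hs₁
  refine Evaluates.branch (.reg k) (fun h => ?_) fun h => ?_
  · rw [if_pos (by by_contra hPa; exact h (hx.trans (if_neg hPa)))]
    exact hp a s₁ hs'
  · rw [if_neg fun hPa => one_ne_zero ((if_pos hPa).symm.trans (hx.symm.trans h))]
    exact hq a s₁ hs'

theorem iterate {n : ι → ℕ} {g : ι × ℕ → ℕ} {B : ι → ℕ} (hg : M.push.PolyTime g)
    (hn : M.PolyTime n) (hf : M.PolyTime f) (hB : M.PolyBounded B)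
    (hle : ∀ a, ∀ i ≤ n a, (fun x => g (a, x))^[i] (f a) ≤ B a) :
    M.PolyTime fun a => (fun x => g (a, x))^[n a] (f a) := by
  refine ⟨hB.mono fun a => hle a _ le_rfl, fun ρ k hρ => ?_⟩
  obtain ⟨p, T, hT, hp⟩ := hf.exists_evaluates ρ k hρ
  obtain ⟨q, U, hU, hq⟩ := hn.exists_evaluates ρ (k + 1) fun i => (hρ i).trans k.lt_succ_self
  obtain ⟨r, V, hV, hr⟩ := hg.exists_evaluates _ (k + 2) (elim_lt hρ (by omega : k < k + 2))
  obtain ⟨V', hV', hVV'⟩ := hV.of_push hB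
  refine ⟨.seq p (.seq q (.loop (.reg (k + 1)) (.seq r (.seq (.assign k (.reg (k + 2)))
    (.assign (k + 1) (.sub (.reg (k + 1)) (.const 1))))))), _,
    hT.add (hU.add ((hn.polyBounded.mul ((PolyBounded.const 2).add (hV'.add (.const 6)))).add
      (.const 2))), fun a s hs => (hp a s hs).bind le_rfl fun s₁ hs₁ hx => ?_⟩
  refine (hq a s₁ (hs.of_frame hρ hs₁)).bind (Nat.le_succ k) fun s₂ hs₂ hy => ?_
  let Inv (i : ℕ) (s' : State) : Prop := Frame k [] s₂ s' ∧
    s'.reg k = (fun x => g (a, x))^[i] (f a) ∧ s'.reg (k + 1) = n a - i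
  have step : ∀ i < n a, ∀ s₃, Inv i s₃ → (Expr.reg (k + 1)).eval s₃ ≠ 0 ∧
      ∃ s₄ t, Run (.seq r (.seq (.assign k (.reg (k + 2)))
        (.assign (k + 1) (.sub (.reg (k + 1)) (.const 1))))) s₃ s₄ t ∧ Inv (i + 1) s₄ ∧
        t ≤ V' a + 6 := by
    rintro i hi s₃ ⟨hs₃, hx₃, hy₃⟩
    have hrep := ((hs.of_frame hρ hs₁).of_frame hρ (hs₂.mono k.le_succ)).of_frame hρ hs₃
    obtain ⟨s₄, t, hrun, hs₄, hx₄, ht⟩ := hr _ _ (hrep.push hx₃)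
    refine ⟨by rw [Expr.eval, hy₃]; omega, _, _,
      .seq hrun (.seq (.assign _ _ _) (.assign _ _ _)), ⟨?_, ?_, ?_⟩, ?_⟩
    · exact ((hs₃.trans (hs₄.mono (by omega))).update le_rfl _).update (by omega) _
    · simp [Expr.eval, hx₄, Function.iterate_succ_apply']
    · simp [Expr.eval, hs₄.reg_eq (k + 1) (by omega), hy₃, Nat.sub_sub]
    · exact Nat.add_le_add (ht.trans (hVV' a _ (hle a i hi.le))) le_rfl
  obtain ⟨s₃, t, hrun, ⟨hs₃, hx₃, -⟩, ht⟩ := run_loop Inv step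
    (fun s₃ h => by rw [Expr.eval, h.2.2, Nat.sub_self])
    ⟨.refl k s₂, (hs₂.reg_eq k k.lt_succ_self).trans hx, hy⟩
  exact ⟨s₃, t, hrun, hs₃, hx₃, ht⟩

theorem congr (hf : M.PolyTime f) (h : ∀ a, f a = g a) : M.PolyTime g := by
  rwa [← funext h]

theorem mul (hf : M.PolyTime f) (hg : M.PolyTime g) : M.PolyTime fun a => f a * g a := by
  have eq : ∀ i a, (· + g a)^[i] 0 = i * g a := fun i a => by simp
  refine (iterate (snd.add hg.lift) hf (const 0) (hf.polyBounded.mul hg.polyBounded)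
    fun a i hi => ?_).congr fun a => eq (f a) a
  exact (eq i a).trans_le (Nat.mul_le_mul_right _ hi)

theorem two_pow (hf : M.PolyTime f) (hB : M.PolyBounded fun a => 2 ^ f a) :
    M.PolyTime fun a => 2 ^ f a := by
  have eq : ∀ i, (fun x => x + x)^[i] 1 = 2 ^ i := fun i => by
    simp [← two_mul, mul_left_iterate]
  refine (iterate (snd.add snd) hf (const 1) hB fun a i hi => ?_).congr fun a => eq (f a)
  exact (eq i).trans_le (Nat.pow_le_pow_right two_pos hi)

theorem of_polyDecidable_lt (hg : M.PolyTime g) (hle : ∀ a, f a ≤ g a)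
    (h : M.push.PolyDecidable fun a => a.2 < f a.1) : M.PolyTime f := by
  have step : M.push.PolyTime fun a => if a.2 < f a.1 then a.2 + 1 else a.2 :=
    (ite h (snd.add (const 1)) snd).congr fun a => by split_ifs <;> rfl
  have eq : ∀ a i, (fun x => if x < f a then x + 1 else x)^[i] 0 = min i (f a) := by
    intro a i
    induction i with
    | zero => simp
    | succ i ih =>
      rw [Function.iterate_succ_apply', ih]
      split_ifs <;> omega
  exact (iterate step hg (const 0) hg.polyBounded fun a i _ =>
    (eq a i).trans_le ((min_le_right _ _).trans (hle a))).congr fun a =>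
      (eq a (g a)).trans (min_eq_right (hle a))

end PolyTime

namespace PolyDecidable

variable {f g : ι → ℕ} {P Q : ι → Prop}

theorem congr (hP : M.PolyDecidable P) (h : ∀ a, P a ↔ Q a) : M.PolyDecidable Q := by
  rwa [← funext fun a => propext (h a)]

theorem not (hP : M.PolyDecidable P) : M.PolyDecidable fun a => ¬P a :=
  (PolyTime.ite hP (.const 0) (.const 1)).congr fun a => by by_cases h : P a <;> simp [h]

theorem and (hP : M.PolyDecidable P) (hQ : M.PolyDecidable Q) :
    M.PolyDecidable fun a => P a ∧ Q a :=
  (PolyTime.ite hP hQ (.const 0)).congr fun a => by split_ifs <;> simp_all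

theorem or (hP : M.PolyDecidable P) (hQ : M.PolyDecidable Q) :
    M.PolyDecidable fun a => P a ∨ Q a :=
  (hP.not.and hQ.not).not.congr fun a => by tauto

theorem imp (hP : M.PolyDecidable P) (hQ : M.PolyDecidable Q) :
    M.PolyDecidable fun a => P a → Q a :=
  (hP.not.or hQ).congr fun _ => imp_iff_not_or.symm

theorem iff (hP : M.PolyDecidable P) (hQ : M.PolyDecidable Q) :
    M.PolyDecidable fun a => P a ↔ Q a :=
  ((hP.imp hQ).and (hQ.imp hP)).congr fun _ => iff_iff_implies_and_implies.symm

theorem ite {C : ι → Prop} [DecidablePred C] (hC : M.PolyDecidable C) (hP : M.PolyDecidable P)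
    (hQ : M.PolyDecidable Q) : M.PolyDecidable fun a => if C a then P a else Q a :=
  ((hC.imp hP).and (hC.not.imp hQ)).congr fun _ => ite_prop_iff_and.symm

theorem le (hf : M.PolyTime f) (hg : M.PolyTime g) : M.PolyDecidable fun a => f a ≤ g a :=
  ((PolyTime.const 1).sub (hf.sub hg)).congr fun a => by split_ifs <;> omega

theorem lt (hf : M.PolyTime f) (hg : M.PolyTime g) : M.PolyDecidable fun a => f a < g a :=
  (le hg hf).not.congr fun _ => not_le

theorem eq (hf : M.PolyTime f) (hg : M.PolyTime g) : M.PolyDecidable fun a => f a = g a :=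
  ((le hf hg).and (le hg hf)).congr fun _ => le_antisymm_iff.symm

theorem const (p : Prop) : M.PolyDecidable fun _ => p := PolyTime.const _

theorem exists_fin {n : ℕ} {P : Fin n → ι → Prop} (hP : ∀ i, M.PolyDecidable (P i)) :
    M.PolyDecidable fun a => ∃ i, P i a := by
  induction n with
  | zero => exact (const False).congr fun a => by simp
  | succ n ih =>
    exact ((hP 0).or (ih fun i => hP i.succ)).congr fun a =>
      (Fin.exists_fin_succ (P := (P · a))).symm

end PolyDecidable

namespace PolyTime

variable {f g : ι → ℕ}

theorem div (hf : M.PolyTime f) (hg : M.PolyTime g) : M.PolyTime fun a => f a / g a := by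
  refine of_polyDecidable_lt hf (fun _ => Nat.div_le_self _ _)
    (((PolyDecidable.lt (.const 0) hg.lift).and
      (.le ((snd.add (const 1)).mul hg.lift) hf.lift)).congr fun b => ?_)
  rcases (g b.1).eq_zero_or_pos with h | h
  · simp [h]
  · rw [and_iff_right h, ← Nat.le_div_iff_mul_le h, Nat.add_one_le_iff]

theorem mod (hf : M.PolyTime f) (hg : M.PolyTime g) : M.PolyTime fun a => f a % g a :=
  (hf.sub (hg.mul (hf.div hg))).congr fun _ => (Nat.mod_eq_sub _ _).symm

theorem sqrt (hf : M.PolyTime f) : M.PolyTime fun a => (f a).sqrt :=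
  of_polyDecidable_lt hf (fun _ => Nat.sqrt_le_self _)
    ((PolyDecidable.le ((snd.add (const 1)).mul (snd.add (const 1))) hf.lift).congr fun _ =>
      Nat.le_sqrt.symm)

theorem div_two_pow (hf : M.PolyTime f) (hg : M.PolyTime g) :
    M.PolyTime fun a => f a / 2 ^ g a := by
  have eq : ∀ a i, (· / 2)^[i] (f a) = f a / 2 ^ i := by
    intro a i
    induction i with
    | zero => simp
    | succ i ih => rw [Function.iterate_succ_apply', ih, Nat.div_div_eq_div_mul, pow_succ]
  exact (iterate (snd.div (const 2)) hg hf hf.polyBounded fun a i _ =>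
    (eq a i).trans_le (Nat.div_le_self _ _)).congr fun a => eq a (g a)

theorem testBit (hf : M.PolyTime f) (hg : M.PolyTime g) :
    M.PolyDecidable fun a => (f a).testBit (g a) :=
  (PolyDecidable.eq ((hf.div_two_pow hg).mod (const 2)) (const 1)).congr fun a => by
    simp [Nat.testBit_eq_decide_div_mod_eq]

end PolyTime

namespace PolyEmits

variable {f n : ι → ℕ} {l l' : ι → List ℕ}

theorem singleton (hf : M.PolyTime f) : M.PolyEmits fun a => [f a] := by
  intro ρ k hρ
  obtain ⟨p, T, hT, hp⟩ := hf.exists_evaluates ρ k hρ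
  exact ⟨.seq p (.emit (.reg k)), _, hT.add (.const 2), fun a s hs =>
    (hp a s hs).bindEmits fun s₁ _ hx =>
      ⟨_, _, .emit _ s₁, by simpa [Expr.eval, hx] using (Frame.refl k s₁).emit (f a), le_rfl⟩⟩

theorem append (hl : M.PolyEmits l) (hl' : M.PolyEmits l') : M.PolyEmits fun a => l a ++ l' a := by
  intro ρ k hρ
  obtain ⟨p, T, hT, hp⟩ := hl ρ k hρ
  obtain ⟨q, U, hU, hq⟩ := hl' ρ k hρ
  exact ⟨.seq p q, _, hT.add hU, fun a s hs =>
    (hp a s hs).append fun s₁ hs₁ => hq a s₁ (hs.of_frame hρ hs₁)⟩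

theorem flatMap_range {l : ι × ℕ → List ℕ} (hl : M.push.PolyEmits l) (hn : M.PolyTime n) :
    M.PolyEmits fun a => (List.range (n a)).flatMap fun i => l (a, i) := by
  intro ρ k hρ
  obtain ⟨p, T, hT, hp⟩ := hn.exists_evaluates ρ k hρ
  have hρ' : ∀ i, ρ i < k + 1 := fun i => (hρ i).trans k.lt_succ_self
  obtain ⟨q, U, hU, hq⟩ := hl _ (k + 2) (elim_lt hρ' k.succ.lt_succ_self)
  obtain ⟨U', hU', hUU'⟩ := hU.of_push hn.polyBounded
  refine ⟨.seq p (.seq (.assign (k + 1) (.const 0)) (.loop (.sub (.reg k) (.reg (k + 1)))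
    (.seq q (.assign (k + 1) (.add (.reg (k + 1)) (.const 1)))))), _,
    hT.add ((PolyBounded.const 2).add ((hn.polyBounded.mul ((PolyBounded.const 4).add
      (hU'.add (.const 4)))).add (.const 4))),
    fun a s hs => (hp a s hs).bindEmits fun s₁ hs₁ hx => ?_⟩
  let Inv (i : ℕ) (s' : State) : Prop :=
    Frame k ((List.range i).flatMap fun j => l (a, j)) s₁ s' ∧ s'.reg k = n a ∧ s'.reg (k + 1) = i
  have step : ∀ i < n a, ∀ s₂, Inv i s₂ → (Expr.sub (.reg k) (.reg (k + 1))).eval s₂ ≠ 0 ∧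
      ∃ s₃ t, Run (.seq q (.assign (k + 1) (.add (.reg (k + 1)) (.const 1)))) s₂ s₃ t ∧
        Inv (i + 1) s₃ ∧ t ≤ U' a + 4 := by
    rintro i hi s₂ ⟨hs₂, hx₂, hy₂⟩
    obtain ⟨s₃, t, hrun, hs₃, ht⟩ :=
      hq _ _ ((((hs.of_frame hρ hs₁).of_frame hρ hs₂)).push hy₂)
    refine ⟨by simp only [Expr.eval, hx₂, hy₂]; omega, _, _, .seq hrun (.assign _ _ _),
      ⟨?_, ?_, ?_⟩, Nat.add_le_add (ht.trans (hUU' a i hi.le)) le_rfl⟩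
    · rw [List.range_succ, List.flatMap_append, List.flatMap_singleton]
      exact (hs₂.trans (hs₃.mono (by omega))).update (by omega) _
    · simp [Expr.eval, hs₃.reg_eq k (by omega), hx₂]
    · simp [Expr.eval, hs₃.reg_eq (k + 1) (by omega), hy₂]
  obtain ⟨s₂, t, hrun, ⟨hs₂, -⟩, ht⟩ := run_loop Inv step
    (s := { s₁ with reg := Function.update s₁.reg (k + 1) 0 })
    (fun s₂ h => by simp only [Expr.eval, h.2.1, h.2.2, Nat.sub_self])
    ⟨(Frame.refl k s₁).update k.le_succ 0, by simpa using hx, by simp⟩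
  exact ⟨s₂, _, .seq (.assign _ _ _) hrun, hs₂, Nat.add_le_add le_rfl ht⟩

end PolyEmits

end InputModel

end RAM

/-! ### Gadgets on natural numbers -/

namespace Gadget

open Vertex

/-- Forgets the bounds on the components of a vertex. -/
def Vertex.val {l p q r b : ℕ} :
    Vertex (Fin l) (Fin p) (Fin q) (Fin r) (Fin b) → Vertex ℕ ℕ ℕ ℕ ℕ
  | forced a c => forced a c
  | portal p => portal p
  | assignment q => assignment q
  | clause r c => clause r c
  | bucket g c => bucket g c
  | hub => hub

section Restrict

variable {l p q r b : ℕ} (X : Gadget ℕ ℕ ℕ ℕ ℕ) (h : ∀ i < q, X.bucketOf i < b)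

/-- The restriction of a gadget on the natural numbers to finitely many labels, portals,
assignments, clauses and buckets. -/
def restrict : Gadget (Fin l) (Fin p) (Fin q) (Fin r) (Fin b) where
  portalCode i := {a | ↑a ∈ X.portalCode i}
  assignmentCode i := {a | ↑a ∈ X.assignmentCode i}
  clauseCode i := {a | ↑a ∈ X.clauseCode i}
  bucketCode i := {a | ↑a ∈ X.bucketCode i}
  bucketOf i := ⟨X.bucketOf i, h i i.2⟩
  Meets i j := X.Meets i j
  Blocks i j := X.Blocks i j

variable {X h}

theorem mem_code_restrict {a : Fin l} {v : Vertex (Fin l) (Fin p) (Fin q) (Fin r) (Fin b)} :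
    a ∈ (X.restrict h).code v ↔ ↑a ∈ X.code v.val := by
  cases v <;> simp [code, val, restrict, Fin.ext_iff]

theorem rel_restrict {u v : Vertex (Fin l) (Fin p) (Fin q) (Fin r) (Fin b)} :
    (X.restrict h).Rel u v ↔ X.Rel u.val v.val := by
  cases u with
  | forced a c => exact mem_code_restrict
  | _ => cases v <;> simp [Rel, val, restrict, Fin.ext_iff]

end Restrict

/-- Reads a number as a vertex: the numbers are distributed, in this order, to `l` pairs of forced
vertices, `p` portals, `q` assignments, `r` pairs of clauses, `b` pairs of buckets, and the hub. -/
def vertexAt (l p q r b x : ℕ) : Vertex ℕ ℕ ℕ ℕ ℕ :=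
  if x < 2 * l then forced (x / 2) (x % 2 = 1)
  else if x - 2 * l < p then portal (x - 2 * l)
  else if x - 2 * l - p < q then assignment (x - 2 * l - p)
  else if x - 2 * l - p - q < 2 * r then
    clause ((x - 2 * l - p - q) / 2) ((x - 2 * l - p - q) % 2 = 1)
  else if x - 2 * l - p - q - 2 * r < 2 * b then
    bucket ((x - 2 * l - p - q - 2 * r) / 2) ((x - 2 * l - p - q - 2 * r) % 2 = 1)
  else hub

section Numbering

variable {l p q r b : ℕ}

theorem val_injective :
    Function.Injective (val : Vertex (Fin l) (Fin p) (Fin q) (Fin r) (Fin b) → _) := by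
  intro u v h
  cases u <;> cases v <;> simp_all [val, Fin.ext_iff]

theorem vertexAt_injOn :
    Set.InjOn (vertexAt l p q r b) (Set.Iio (2 * l + p + q + 2 * r + 2 * b + 1)) := by
  intro x hx y hy h
  simp only [Set.mem_Iio] at hx hy
  unfold vertexAt at h
  split_ifs at h <;> simp at h <;> grind

theorem exists_val_eq_vertexAt (x : ℕ) :
    ∃ v : Vertex (Fin l) (Fin p) (Fin q) (Fin r) (Fin b), v.val = vertexAt l p q r b x := by
  unfold vertexAt
  split_ifs
  · exact ⟨forced ⟨x / 2, by omega⟩ _, rfl⟩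
  · exact ⟨portal ⟨_, by assumption⟩, rfl⟩
  · exact ⟨assignment ⟨_, by assumption⟩, rfl⟩
  · exact ⟨clause ⟨_ / 2, by omega⟩ _, rfl⟩
  · exact ⟨bucket ⟨_ / 2, by omega⟩ _, rfl⟩
  · exact ⟨hub, rfl⟩

theorem exists_vertexAt_eq_val (v : Vertex (Fin l) (Fin p) (Fin q) (Fin r) (Fin b)) :
    ∃ x < 2 * l + p + q + 2 * r + 2 * b + 1, vertexAt l p q r b x = v.val := by
  cases v with
  | forced i c =>
    have hlt : 2 * (i : ℕ) + c.toNat < 2 * l := by grind [c.toNat_le]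
    refine ⟨2 * i + c.toNat, by omega, ?_⟩
    cases c <;> simp_all [vertexAt, val, Nat.mul_add_div]
  | portal i => exact ⟨2 * l + i, by omega, by simp [vertexAt, val]⟩
  | assignment i => exact ⟨2 * l + p + i, by omega, by simp [vertexAt, val, Nat.add_assoc]⟩
  | clause i c =>
    have hlt : 2 * (i : ℕ) + c.toNat < 2 * r := by grind [c.toNat_le]
    refine ⟨2 * l + p + q + (2 * i + c.toNat), by omega, ?_⟩
    cases c <;> simp_all [vertexAt, val, Nat.mul_add_div, Nat.add_assoc]
  | bucket i c =>
    have hlt : 2 * (i : ℕ) + c.toNat < 2 * b := by grind [c.toNat_le]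
    refine ⟨2 * l + p + q + 2 * r + (2 * i + c.toNat), by omega, ?_⟩
    cases c <;> simp_all [vertexAt, val, Nat.mul_add_div, Nat.add_assoc]
  | hub => exact ⟨2 * l + p + q + 2 * r + 2 * b, by omega, by simp [vertexAt, val, Nat.add_assoc]⟩

/-- The restricted gadget graph, with its vertices numbered by `vertexAt`. -/
def numberedGraph (X : Gadget ℕ ℕ ℕ ℕ ℕ) (l p q r b : ℕ) :
    SimpleGraph (Fin (2 * l + p + q + 2 * r + 2 * b + 1)) :=
  SimpleGraph.fromRel fun x y => X.Rel (vertexAt l p q r b x) (vertexAt l p q r b y)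

theorem nonempty_numberedGraph_iso {X : Gadget ℕ ℕ ℕ ℕ ℕ} (h : ∀ i < q, X.bucketOf i < b) :
    Nonempty (X.numberedGraph l p q r b ≃g
      (X.restrict h : Gadget (Fin l) (Fin p) _ (Fin r) _).graph) := by
  choose f hf using fun x : Fin (2 * l + p + q + 2 * r + 2 * b + 1) =>
    exists_val_eq_vertexAt (l := l) (p := p) (q := q) (r := r) (b := b) x
  have f_bijective : Function.Bijective f := by
    refine ⟨fun x y hxy => Fin.ext (vertexAt_injOn x.2 y.2 ?_), fun v => ?_⟩
    · rw [← hf, ← hf, hxy]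
    · obtain ⟨x, hx, hxv⟩ := exists_vertexAt_eq_val v
      exact ⟨⟨x, hx⟩, val_injective ((hf _).trans hxv)⟩
  refine ⟨⟨Equiv.ofBijective f f_bijective, fun {x y} => ?_⟩⟩
  simp [numberedGraph, graph, rel_restrict, hf, f_bijective.injective.eq_iff]

end Numbering

end Gadget

/-! ### The gadget of a formula -/

/-- The code of the `x`-th member of the family `t`: the labels of parity `t` that stand for the
positions below `K` of the binary digits `1` of `x`, and the two last labels of this parity. By the
latter it differs from the codes of the forced vertices, which are singletons. -/
def codeword (K t x : ℕ) : Set ℕ := {j | j % 2 = t ∧ (K ≤ j / 2 ∨ x.testBit (j / 2))}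

section Codeword

variable {K s t x y : ℕ}

theorem codeword_inj (hs : s < 2) (hx : x < 2 ^ K) (hy : y < 2 ^ K)
    (h : {a : Fin (2 * (K + 2)) | ↑a ∈ codeword K s x} =
      {a : Fin (2 * (K + 2)) | ↑a ∈ codeword K t y}) : s = t ∧ x = y := by
  have mem_iff : ∀ j < 2 * (K + 2), j ∈ codeword K s x ↔ j ∈ codeword K t y := fun j hj =>
    Set.ext_iff.1 h ⟨j, hj⟩
  have hst : s = t := by
    simpa [codeword, Nat.mul_add_div, Nat.mod_eq_of_lt hs] using mem_iff (2 * K + s) (by omega)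
  refine ⟨hst, Nat.eq_of_testBit_eq fun i => ?_⟩
  rcases lt_or_ge i K with hi | hi
  · have := mem_iff (2 * i + s) (by omega)
    simpa [codeword, ← hst, Nat.mod_eq_of_lt hs, show (2 * i + s) / 2 = i by omega, hi.not_ge]
      using this
  · rw [Nat.testBit_eq_false_of_lt (hx.trans_le (Nat.pow_le_pow_right two_pos hi)),
      Nat.testBit_eq_false_of_lt (hy.trans_le (Nat.pow_le_pow_right two_pos hi))]

theorem singleton_ne_codeword (ht : t < 2) (a : Fin (2 * (K + 2))) :
    {a} ≠ {a : Fin (2 * (K + 2)) | ↑a ∈ codeword K t x} := by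
  intro h
  have eq : ∀ i (hi : i < 2), (⟨2 * (K + i) + t, by omega⟩ : Fin (2 * (K + 2))) = a := fun i hi =>
    (Set.ext_iff.1 h _).2 ⟨by dsimp; omega, .inl (by dsimp; omega)⟩
  simpa using (eq 0 two_pos).trans (eq 1 one_lt_two).symm

theorem codeword_ne_univ (ht : t < 2) :
    {a : Fin (2 * (K + 2)) | ↑a ∈ codeword K t x} ≠ Set.univ := fun h => by
  have := (Set.eq_univ_iff_forall.1 h ⟨1 - t, by omega⟩).1
  dsimp at this
  omega

end Codeword

namespace PartitionedSAT

variable (ψ : PartitionedSAT)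

/-- The number `b` of rows and of columns in which the variables of each part are arranged: the
variable `x_{d,i}` lies in the row `i / b` and in the column `i % b` of the part `d`. There is a
bucket for every row `y` of every part `d`; it has the number `g = d * b + y`, and its assignments
`g * 2 ^ b + z` list the values of the variables of this row as the binary digits of `z < 2 ^ b`. -/
def side : ℕ := ψ.n.sqrt + 1

/-- The bucket of the variable `x_{d,i}`. -/
def bucket (d i : ℕ) : ℕ := d * ψ.side + i / ψ.side

/-- The number of binary digits that are used to tell vertices apart. -/
def codeLength : ℕ := 15 * ψ.side

/-- The portals below `3 * b` stand for the buckets. The portal `(3 * t + d) * b + y` for `t = 1`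
and `t = 2` stands for the value `true` and `false` in the column `y` of the part `d`. -/
def PortalMeets (p q : ℕ) : Prop :=
  if p < 3 * ψ.side then p = q / 2 ^ ψ.side
  else p / ψ.side % 3 = q / 2 ^ ψ.side / ψ.side ∧
    (q.testBit (p % ψ.side) ↔ p / (3 * ψ.side) = 1)

/-- The portals blocked by the literal of the variable `x_{d,i}` with the sign `s`: its bucket, and
the values in the columns of its part, except for the one which makes the literal false. An
assignment makes the literal true if and only if all portals that it meets are blocked. -/
def LiteralBlocks (d i s p : ℕ) : Prop :=
  if p < 3 * ψ.side then p = ψ.bucket d i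
  else p / ψ.side % 3 = d ∧ (p % ψ.side = i % ψ.side → p / (3 * ψ.side) ≠ s + 1)

/-- The gadget of the formula, with unbounded numbers of labels, portals and so on. -/
def numericGadget : Gadget ℕ ℕ ℕ ℕ ℕ where
  portalCode p := codeword ψ.codeLength 0 (3 * p)
  assignmentCode q := codeword ψ.codeLength 0 (3 * q + 1)
  bucketCode g := codeword ψ.codeLength 0 (3 * g + 2)
  clauseCode r := codeword ψ.codeLength 1 r
  bucketOf q := q / 2 ^ ψ.side
  Meets := ψ.PortalMeets
  Blocks r p := ∃ h : r < ψ.clauses.length, ∃ l ∈ ψ.clauses[r],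
    ψ.LiteralBlocks l.part l.index l.positive.toNat p

theorem numericGadget_bucketOf_lt :
    ∀ q < 3 * ψ.side * 2 ^ ψ.side, ψ.numericGadget.bucketOf q < 3 * ψ.side :=
  fun _ hq => (Nat.div_lt_iff_lt_mul (Nat.two_pow_pos _)).2 hq

/-- The gadget of the formula. -/
def gadget : Gadget (Fin (2 * (ψ.codeLength + 2))) (Fin (9 * ψ.side))
    (Fin (3 * ψ.side * 2 ^ ψ.side)) (Fin ψ.clauses.length) (Fin (3 * ψ.side)) :=
  ψ.numericGadget.restrict ψ.numericGadget_bucketOf_lt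

variable {ψ}

theorem lt_side_mul_side : ψ.n < ψ.side * ψ.side := Nat.lt_succ_sqrt _

theorem side_pos : 0 < ψ.side := Nat.succ_pos _

theorem six_mul_n_add_one_le : 6 * ψ.n + 1 ≤ 2 ^ (5 * ψ.side) := by
  have hb : ψ.side ≤ 2 ^ ψ.side := Nat.lt_two_pow_self.le
  have hpos : 1 ≤ ψ.side := ψ.side_pos
  calc 6 * ψ.n + 1 ≤ 2 ^ 3 * (ψ.side * ψ.side) := by have := ψ.lt_side_mul_side; omega
    _ ≤ 2 ^ (3 * ψ.side) * (2 ^ ψ.side * 2 ^ ψ.side) := by gcongr <;> omega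
    _ = 2 ^ (5 * ψ.side) := by ring

theorem clauses_length_le : ψ.clauses.length ≤ 2 ^ ψ.codeLength := by
  let triple (C : List (Literal ψ.n)) (i : Fin 3) : Option (Fin 3 × Fin ψ.n × Bool) :=
    C[(i : ℕ)]?.map fun l => (l.part, l.index, l.positive)
  have triple_inj : ∀ C ∈ ψ.clauses, ∀ D ∈ ψ.clauses, triple C = triple D → C = D := by
    intro C hC D hD h
    refine List.ext_getElem? fun i => ?_
    rcases lt_or_ge i 3 with hi | hi
    · refine Option.map_injective (fun l l' hl => ?_) (congrFun h ⟨i, hi⟩)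
      cases l; cases l'; simp_all
    · rw [List.getElem?_eq_none ((ψ.length_le C hC).trans hi),
        List.getElem?_eq_none ((ψ.length_le D hD).trans hi)]
  calc ψ.clauses.length ≤ (3 * (ψ.n * 2) + 1) ^ 3 := by
        simpa using (ψ.nodup.map_on triple_inj).length_le_card
    _ ≤ (2 ^ (5 * ψ.side)) ^ 3 := by
        gcongr
        have := ψ.six_mul_n_add_one_le
        omega
    _ = 2 ^ ψ.codeLength := by rw [codeLength, ← pow_mul]; ring_nf

theorem twentyseven_mul_side_mul_two_pow_lt :
    27 * (ψ.side * 2 ^ ψ.side) + 2 < 2 ^ ψ.codeLength := by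
  have hb : ψ.side ≤ 2 ^ ψ.side := Nat.lt_two_pow_self.le
  have hpos : 1 ≤ ψ.side := ψ.side_pos
  calc 27 * (ψ.side * 2 ^ ψ.side) + 2 < 2 ^ 5 * (ψ.side * 2 ^ ψ.side) := by
        have := Nat.mul_le_mul hpos (hpos.trans hb)
        omega
    _ ≤ 2 ^ (5 * ψ.side) * (2 ^ ψ.side * 2 ^ ψ.side) := by gcongr <;> omega
    _ ≤ 2 ^ ψ.codeLength := by
        rw [← pow_add, ← pow_add]
        exact Nat.pow_le_pow_right two_pos (by rw [codeLength]; omega)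

theorem eq_or_eq_twin_of_code_gadget_eq
    {u v : Gadget.Vertex (Fin (2 * (ψ.codeLength + 2))) (Fin (9 * ψ.side))
      (Fin (3 * ψ.side * 2 ^ ψ.side)) (Fin ψ.clauses.length) (Fin (3 * ψ.side))}
    (h : ψ.gadget.code u = ψ.gadget.code v) : v = u ∨ v = u.twin := by
  have hlt := ψ.twentyseven_mul_side_mul_two_pow_lt
  have hside : ψ.side ≤ ψ.side * 2 ^ ψ.side := Nat.le_mul_of_pos_right _ (Nat.two_pow_pos _)
  have hp (p : Fin (9 * ψ.side)) : 3 * (p : ℕ) < 2 ^ ψ.codeLength := by omega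
  have hq (q : Fin (3 * ψ.side * 2 ^ ψ.side)) : 3 * (q : ℕ) + 1 < 2 ^ ψ.codeLength := by
    have := q.2.trans_eq (mul_assoc ..)
    omega
  have hg (g : Fin (3 * ψ.side)) : 3 * (g : ℕ) + 2 < 2 ^ ψ.codeLength := by omega
  have hr (r : Fin ψ.clauses.length) : (r : ℕ) < 2 ^ ψ.codeLength :=
    r.2.trans_le ψ.clauses_length_le
  cases u <;> cases v <;>
    dsimp only [gadget, Gadget.code, Gadget.restrict, numericGadget] at h <;>
  first
  | exact absurd h (singleton_ne_codeword (by omega) _)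
  | exact absurd h.symm (singleton_ne_codeword (by omega) _)
  | exact absurd h (codeword_ne_univ (by omega))
  | exact absurd h.symm (codeword_ne_univ (by omega))
  | exact absurd h (Set.singleton_ne_univ _)
  | exact absurd h.symm (Set.singleton_ne_univ _)
  | have := codeword_inj (by omega) (by solve_by_elim) (by solve_by_elim) h
    first
    | omega
    | simp_all [Gadget.Vertex.twin, Fin.val_inj, Bool.eq_or_eq_not]
  | simp_all [Gadget.Vertex.twin, Bool.eq_or_eq_not]

theorem gadget_separating : ψ.gadget.Separating where
  eq_or_eq_twin _ _ := eq_or_eq_twin_of_code_gadget_eq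
  disjoint_code q r := Set.disjoint_left.2 fun a hq hr => zero_ne_one (hq.1.symm.trans hr.1)
  inter_code_nonempty q g := ⟨⟨2 * ψ.codeLength, by omega⟩, ⟨by simp, .inl (by simp)⟩,
    ⟨by simp, .inl (by simp)⟩⟩
  exists_meets q := by
    have hq : q / 2 ^ ψ.side < 3 * ψ.side := ψ.numericGadget_bucketOf_lt q q.2
    exact ⟨⟨q / 2 ^ ψ.side, by omega⟩, by
      simp [gadget, Gadget.restrict, numericGadget, PortalMeets, hq]⟩
  bucketOf_surjective g := ⟨⟨g * 2 ^ ψ.side, Nat.mul_lt_mul_of_pos_right g.2 (Nat.two_pow_pos _)⟩,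
    Fin.ext (Nat.mul_div_cancel _ (Nat.two_pow_pos _))⟩

section Solution

variable {d i p q : ℕ} {s : Bool}

theorem index_div_side_lt (hi : i < ψ.n) : i / ψ.side < ψ.side :=
  Nat.div_lt_of_lt_mul (hi.trans ψ.lt_side_mul_side)

theorem bucket_div_side (hi : i < ψ.n) : ψ.bucket d i / ψ.side = d := by
  rw [bucket, mul_comm, Nat.mul_add_div ψ.side_pos, Nat.div_eq_of_lt (ψ.index_div_side_lt hi),
    add_zero]

theorem bucket_lt (hd : d < 3) (hi : i < ψ.n) : ψ.bucket d i < 3 * ψ.side :=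
  (Nat.div_lt_iff_lt_mul ψ.side_pos).1 (by rwa [bucket_div_side hi])

theorem bucket_inj {d' i' : ℕ} (hi : i < ψ.n) (hi' : i' < ψ.n)
    (h : ψ.bucket d i = ψ.bucket d' i') (hmod : i % ψ.side = i' % ψ.side) : d = d' ∧ i = i' := by
  obtain rfl : d = d' := by rw [← ψ.bucket_div_side (d := d) hi, h, bucket_div_side hi']
  exact ⟨rfl, by rw [← Nat.div_add_mod i ψ.side, Nat.add_left_cancel h, hmod, Nat.div_add_mod]⟩

theorem literalBlocks_of_portalMeets (hi : i < ψ.n) (hq : q / 2 ^ ψ.side = ψ.bucket d i)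
    (hs : q.testBit (i % ψ.side) = s) (h : ψ.PortalMeets p q) :
    ψ.LiteralBlocks d i s.toNat p := by
  unfold PortalMeets at h
  unfold LiteralBlocks
  rw [hq, bucket_div_side hi] at h
  split_ifs at h ⊢ with hp
  · exact h
  · refine ⟨h.1, fun hcol => ?_⟩
    rw [hcol, hs] at h
    cases s <;> simp_all

theorem exists_portalMeets_and_literalBlocks_imp (hd : d < 3) (hi : i < ψ.n)
    (hq : q / 2 ^ ψ.side = ψ.bucket d i) :
    ∃ p < 9 * ψ.side, ψ.PortalMeets p q ∧ ∀ d' i' s, ψ.LiteralBlocks d' i' s.toNat p →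
      d = d' ∧ (i = i' → q.testBit (i % ψ.side) = s) := by
  have hb := ψ.side_pos
  let t := if q.testBit (i % ψ.side) then 1 else 2
  have ht : 1 ≤ t ∧ t ≤ 2 := by grind
  let p := (3 * t + d) * ψ.side + i % ψ.side
  have hmod : p % ψ.side = i % ψ.side := by simp [p]
  have hdiv : p / ψ.side = 3 * t + d := by
    rw [show p = ψ.side * (3 * t + d) + i % ψ.side by rw [mul_comm], Nat.mul_add_div hb,
      Nat.div_eq_of_lt (Nat.mod_lt i hb), add_zero]
  have hp : ¬p < 3 * ψ.side := by
    rw [← Nat.div_lt_iff_lt_mul hb]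
    omega
  have hpart : p / ψ.side % 3 = d := by omega
  have hsign : p / (3 * ψ.side) = t := by rw [mul_comm, ← Nat.div_div_eq_div_mul]; omega
  refine ⟨p, (Nat.div_lt_iff_lt_mul hb).1 (by omega), ?_, fun d' i' s h => ?_⟩
  · simp [PortalMeets, hp, hpart, hmod, hsign, hq, bucket_div_side hi, t]
  · simp only [LiteralBlocks, if_neg hp, hpart, hmod, hsign] at h
    refine ⟨h.1, ?_⟩
    rintro rfl
    have := h.2 rfl
    cases s <;> grind

/-- The assignment of the bucket `g` that lists the values under `π`. -/
noncomputable def rowAssignment (π : Fin 3 → Fin ψ.n → Bool) (g : ℕ) : ℕ :=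
  2 ^ ψ.side * g + Nat.ofBits fun y : Fin ψ.side =>
    decide (∃ d i, π d i = true ∧ ψ.bucket d i = g ∧ (i : ℕ) % ψ.side = y)

theorem rowAssignment_div (π : Fin 3 → Fin ψ.n → Bool) (g : ℕ) :
    rowAssignment π g / 2 ^ ψ.side = g := by
  rw [rowAssignment, Nat.mul_add_div (Nat.two_pow_pos _),
    Nat.div_eq_of_lt (Nat.ofBits_lt_two_pow _), add_zero]

theorem testBit_rowAssignment (π : Fin 3 → Fin ψ.n → Bool) (d : Fin 3) (i : Fin ψ.n) :
    (rowAssignment π (ψ.bucket d i)).testBit (i % ψ.side) = π d i := by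
  have hlt : (i : ℕ) % ψ.side < ψ.side := Nat.mod_lt _ ψ.side_pos
  rw [rowAssignment, Nat.testBit_two_pow_mul_add _ (Nat.ofBits_lt_two_pow _), if_pos hlt,
    Nat.testBit_ofBits_lt _ _ hlt, Bool.eq_iff_iff, decide_eq_true_iff]
  refine ⟨fun ⟨d', i', hπ, hg, hcol⟩ => ?_, fun hπ => ⟨d, i, hπ, rfl, rfl⟩⟩
  obtain ⟨hd, hi⟩ := bucket_inj i'.2 i.2 hg hcol
  rwa [← Fin.ext hd, ← Fin.ext hi]

theorem Satisfiable.exists_isSolution (h : ψ.Satisfiable) : ∃ σ, ψ.gadget.IsSolution σ := by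
  obtain ⟨π, hπ⟩ := h
  refine ⟨fun g => ⟨rowAssignment π g, (Nat.div_lt_iff_lt_mul (Nat.two_pow_pos _)).1 ?_⟩,
    fun g => Fin.ext (rowAssignment_div π g), fun r => ?_⟩
  · exact (rowAssignment_div π g).trans_lt g.2
  obtain ⟨l, hl, hlπ⟩ := hπ _ (List.getElem_mem r.2)
  exact ⟨⟨ψ.bucket l.part l.index, bucket_lt l.part.2 l.index.2⟩, fun p hp =>
    ⟨r.2, l, hl, literalBlocks_of_portalMeets l.index.2 (rowAssignment_div π _)
      ((testBit_rowAssignment π _ _).trans hlπ) hp⟩⟩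

theorem satisfiable_of_isSolution {σ} (hσ : ψ.gadget.IsSolution σ) : ψ.Satisfiable := by
  refine ⟨fun d i => (σ ⟨ψ.bucket d i, bucket_lt d.2 i.2⟩ : ℕ).testBit (i % ψ.side),
    fun C hC => ?_⟩
  obtain ⟨r, hr, rfl⟩ := List.mem_iff_getElem.1 hC
  obtain ⟨g, hg⟩ := hσ.2 ⟨r, hr⟩
  have hq : (σ g : ℕ) / 2 ^ ψ.side = g := congrArg Fin.val (hσ.1 g)
  obtain ⟨_, l, hl, hblock⟩ := hg ⟨g, by omega⟩ (by
    simp [gadget, Gadget.restrict, numericGadget, PortalMeets, hq])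
  have hlg : (g : ℕ) = ψ.bucket l.part l.index := by simpa [LiteralBlocks] using hblock
  obtain ⟨p, hp, hpq, hpl⟩ :=
    exists_portalMeets_and_literalBlocks_imp l.part.2 l.index.2 (hq.trans hlg)
  obtain ⟨_, l', hl', hblock'⟩ := hg ⟨p, hp⟩ hpq
  obtain ⟨hpart, hsign⟩ := hpl _ _ _ hblock'
  have hindex := ψ.one_per_part _ hC l hl l' hl' (Fin.ext hpart)
  refine ⟨l', hl', ?_⟩
  rw [← hsign (congrArg _ hindex)]
  simp only [← Fin.ext hpart, ← hindex, ← hlg]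

theorem satisfiable_iff_exists_isSolution : ψ.Satisfiable ↔ ∃ σ, ψ.gadget.IsSolution σ :=
  ⟨Satisfiable.exists_isSolution, fun ⟨_, hσ⟩ => satisfiable_of_isSolution hσ⟩

end Solution

variable (ψ) in
/-- The instance of Metric Dimension that the reduction constructs. -/
def target : MetricDimensionInstance where
  numVerts := _
  graph := ψ.numericGadget.numberedGraph (2 * (ψ.codeLength + 2)) (9 * ψ.side)
    (3 * ψ.side * 2 ^ ψ.side) ψ.clauses.length (3 * ψ.side)
  k := 2 * (ψ.codeLength + 2) + 3 * ψ.side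
  k_pos := by omega

theorem satisfiable_iff_isYes_target : ψ.Satisfiable ↔ ψ.target.IsYes := by
  obtain ⟨e⟩ : Nonempty (ψ.target.graph ≃g ψ.gadget.graph) :=
    Gadget.nonempty_numberedGraph_iso ψ.numericGadget_bucketOf_lt
  rw [satisfiable_iff_exists_isSolution,
    ← Gadget.exists_isResolvingSet_iff_exists_isSolution gadget_separating, Fintype.card_fin,
    Fintype.card_fin]
  exact ⟨exists_card_le_isResolvingSet_of_iso e.symm, exists_card_le_isResolvingSet_of_iso e⟩

theorem exists_vertexCoverNum_target_eq :
    ∃ vc : ℕ, ψ.target.graph.vertexCoverNum = vc ∧ vc + ψ.target.k ≤ 121 * ψ.side := by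
  obtain ⟨e⟩ : Nonempty (ψ.target.graph ≃g ψ.gadget.graph) :=
    Gadget.nonempty_numberedGraph_iso ψ.numericGadget_bucketOf_lt
  have hle := ψ.gadget.vertexCoverNum_graph_le
  rw [← SimpleGraph.vertexCoverNum_congr e] at hle
  obtain ⟨vc, hvc⟩ := ENat.ne_top_iff_exists.1 ψ.target.graph.vertexCoverNum_ne_top_of_finite
  refine ⟨vc, hvc.symm, ?_⟩
  rw [← hvc, Nat.cast_le, Fintype.card_fin, Fintype.card_fin, Fintype.card_fin] at hle
  have := ψ.side_pos
  simp only [target, codeLength] at hle ⊢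
  omega

end PartitionedSAT

/-! ### Reading the formula -/

/-- The part of the encoding of a formula that stands for a literal. -/
def Literal.code {n : ℕ} (l : Literal n) : List ℕ :=
  [(l.part : ℕ), (l.index : ℕ), if l.positive then 1 else 0]

/-- The part of the encoding of a formula that stands for a clause. -/
def clauseCode {n : ℕ} (C : List (Literal n)) : List ℕ := C.length :: C.flatMap Literal.code

theorem getD_flatMap {α β : Type*} {f : α → List β} {l : List α} {r i : ℕ} (hr : r < l.length)
    (hi : i < (f l[r]).length) (d : β) :
    (l.flatMap f).getD (((l.take r).flatMap f).length + i) d = (f l[r]).getD i d := by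
  have split : l.flatMap f = (l.take r).flatMap f ++ (f l[r] ++ (l.drop (r + 1)).flatMap f) := by
    rw [← List.flatMap_cons, ← List.drop_eq_getElem_cons hr, ← List.flatMap_append,
      List.take_append_drop]
  rw [split, List.getD_append_right _ _ _ _ (Nat.le_add_right _ _),
    Nat.add_sub_cancel_left, List.getD_append _ _ _ _ hi]

section Read

variable {n : ℕ} {C : List (Literal n)}

theorem length_flatMap_literalCode : (C.flatMap Literal.code).length = 3 * C.length := by
  simp [Literal.code, mul_comm]

theorem length_clauseCode : (clauseCode C).length = 3 * C.length + 1 := by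
  rw [clauseCode, List.length_cons, length_flatMap_literalCode]

theorem getD_clauseCode {j t : ℕ} (hj : j < C.length) (ht : t < 3) :
    (clauseCode C).getD (1 + 3 * j + t) 0 = C[j].code.getD t 0 := by
  have h := getD_flatMap (f := Literal.code) hj (i := t) ht 0
  rw [length_flatMap_literalCode, List.length_take, min_eq_left hj.le] at h
  rwa [clauseCode, add_assoc, add_comm 1, List.getD_cons_succ]

end Read

namespace PartitionedSAT

/-- The content of the memory cell `i` at the start of a computation. -/
def cell (ψ : PartitionedSAT) (i : ℕ) : ℕ := ψ.encode.getD i 0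

/-- The address from which on the clause `r` is stored. -/
def clauseAddress (ψ : PartitionedSAT) (r : ℕ) : ℕ :=
  ((ψ.clauses.take r).flatMap clauseCode).length + 2

variable {ψ : PartitionedSAT} {r i j p : ℕ}

theorem cell_clauseAddress_add (hr : r < ψ.clauses.length)
    (hi : i < (clauseCode ψ.clauses[r]).length) :
    ψ.cell (ψ.clauseAddress r + i) = (clauseCode ψ.clauses[r]).getD i 0 := by
  rw [← getD_flatMap hr hi 0, clauseAddress, add_right_comm]
  rfl

theorem cell_clauseAddress (hr : r < ψ.clauses.length) :
    ψ.cell (ψ.clauseAddress r) = ψ.clauses[r].length :=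
  cell_clauseAddress_add (i := 0) hr (Nat.succ_pos _)

theorem cell_clauseAddress_literal (hr : r < ψ.clauses.length) (hj : j < ψ.clauses[r].length)
    {t : ℕ} (ht : t < 3) :
    ψ.cell (ψ.clauseAddress r + (1 + 3 * j + t)) = ψ.clauses[r][j].code.getD t 0 := by
  rw [cell_clauseAddress_add hr (by rw [length_clauseCode]; omega), getD_clauseCode hj ht]

theorem clauseAddress_succ (hr : r < ψ.clauses.length) :
    ψ.clauseAddress (r + 1) = ψ.clauseAddress r + 1 + 3 * ψ.cell (ψ.clauseAddress r) := by
  rw [cell_clauseAddress hr, clauseAddress, List.take_succ_eq_append_getElem hr,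
    List.flatMap_append, List.length_append, List.flatMap_singleton, length_clauseCode,
    clauseAddress]
  ring

theorem iterate_eq_clauseAddress (hr : r ≤ ψ.clauses.length) :
    (fun x => x + 1 + 3 * ψ.cell x)^[r] 2 = ψ.clauseAddress r := by
  induction r with
  | zero => rfl
  | succ r ih => rw [Function.iterate_succ_apply', ih (by omega), clauseAddress_succ hr]

theorem clauseAddress_le (hr : r ≤ ψ.clauses.length) : ψ.clauseAddress r ≤ 10 * r + 2 := by
  induction r with
  | zero => rfl
  | succ r ih =>
    have := ψ.length_le _ (List.getElem_mem hr)
    rw [clauseAddress_succ hr, cell_clauseAddress hr]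
    omega

theorem literalBlocks_cell_iff (hr : r < ψ.clauses.length) (hj : j < ψ.clauses[r].length) :
    ψ.LiteralBlocks (ψ.cell (ψ.clauseAddress r + (1 + 3 * j)))
      (ψ.cell (ψ.clauseAddress r + (1 + 3 * j + 1)))
      (ψ.cell (ψ.clauseAddress r + (1 + 3 * j + 2))) p ↔
    ψ.LiteralBlocks ψ.clauses[r][j].part ψ.clauses[r][j].index
      ψ.clauses[r][j].positive.toNat p := by
  have h := fun t => cell_clauseAddress_literal hr hj (t := t)
  have h0 := h 0 (by norm_num)
  rw [add_zero] at h0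
  rw [h0, h 1 (by norm_num), h 2 (by norm_num)]
  cases h : ψ.clauses[r][j].positive <;> simp [Literal.code, h]

theorem numericGadget_blocks_iff : ψ.numericGadget.Blocks r p ↔
    r < ψ.clauses.length ∧ ∃ j : Fin 3, (j : ℕ) < ψ.cell (ψ.clauseAddress r) ∧
      ψ.LiteralBlocks (ψ.cell (ψ.clauseAddress r + (1 + 3 * j)))
        (ψ.cell (ψ.clauseAddress r + (1 + 3 * j + 1)))
        (ψ.cell (ψ.clauseAddress r + (1 + 3 * j + 2))) p := by
  rw [← exists_prop]
  refine exists_congr fun hr => ?_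
  have hlen := ψ.length_le _ (List.getElem_mem hr)
  have key (j : ℕ) (hj : j < ψ.clauses[r].length) := literalBlocks_cell_iff hr hj (p := p)
  rw [cell_clauseAddress hr]
  constructor
  · rintro ⟨l, hl, h⟩
    obtain ⟨j, hj, rfl⟩ := List.mem_iff_getElem.1 hl
    exact ⟨⟨j, hj.trans_le hlen⟩, hj, (key j hj).2 h⟩
  · rintro ⟨j, hj, h⟩
    exact ⟨_, List.getElem_mem hj, (key j hj).1 h⟩

end PartitionedSAT

/-! ### The algorithm -/

namespace PartitionedSAT

theorem cell_le (ψ : PartitionedSAT) (i : ℕ) : ψ.cell i ≤ 2 ^ ψ.codeLength := by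
  have hn := ψ.six_mul_n_add_one_le.trans
    (Nat.pow_le_pow_right two_pos (by rw [codeLength]; omega : _ ≤ ψ.codeLength))
  have hside := ψ.twentyseven_mul_side_mul_two_pow_lt
  have entry_le : ∀ x ∈ ψ.encode, x ≤ 2 ^ ψ.codeLength := by
    simp only [encode, List.mem_cons, List.mem_flatMap, List.not_mem_nil, or_false]
    rintro x (rfl | rfl | ⟨C, hC, rfl | ⟨l, -, rfl | rfl | rfl⟩⟩)
    · omega
    · exact clauses_length_le
    · have := ψ.length_le C hC
      omega
    · omega
    · omega
    · split_ifs <;> omega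
  rw [cell, List.getD_eq_getElem?_getD]
  cases h : ψ.encode[i]? with
  | none => exact Nat.zero_le _
  | some x => exact entry_le x (List.mem_of_getElem? h)

/-- The formulas as inputs: they are stored in the memory, and no further number is passed. -/
def inputModel : RAM.InputModel PartitionedSAT Empty where
  arg _ := Empty.elim
  mem := cell
  size ψ := 2 ^ ψ.codeLength
  arg_le _ i := i.elim
  mem_le := cell_le

/-- The inputs of `M` have the formulas `φ` in their memory, and are so large that time polynomial
in `2 ^ O(b)` is available. -/
structure IsStored {ι σ : Type*} (M : RAM.InputModel ι σ) (φ : ι → PartitionedSAT) : Prop where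
  mem_eq : ∀ a i, M.mem a i = (φ a).cell i
  polyBounded : M.PolyBounded fun a => 2 ^ (φ a).codeLength

theorem isStored_inputModel : IsStored inputModel id :=
  ⟨fun _ _ => rfl, .size⟩

end PartitionedSAT

open RAM.InputModel in
theorem polyDecidable_mem_codeword {ι σ : Type*} {M : RAM.InputModel ι σ} {K x y : ι → ℕ}
    (hK : M.PolyTime K) (hx : M.PolyTime x) (hy : M.PolyTime y)
    (t : ℕ) : M.PolyDecidable fun a => y a ∈ codeword (K a) t (x a) :=
  (PolyDecidable.eq (hy.mod (.const 2)) (.const t)).and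
    ((PolyDecidable.le hK (hy.div (.const 2))).or (hx.testBit (hy.div (.const 2))))

namespace Gadget

open RAM.InputModel Vertex

/-- The predicate `F` on vertices can be decided in polynomial time, where the components of the
vertex are computed in polynomial time from the input. -/
structure VertexPolyDecidable {ι σ : Type*} (M : RAM.InputModel ι σ)
    (F : ι → Vertex ℕ ℕ ℕ ℕ ℕ → Prop) : Prop where
  forced : ∀ y (c : ι → Bool), M.PolyTime y → M.PolyDecidable (c · = true) →
    M.PolyDecidable fun a => F a (forced (y a) (c a))
  portal : ∀ y, M.PolyTime y → M.PolyDecidable fun a => F a (portal (y a))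
  assignment : ∀ y, M.PolyTime y → M.PolyDecidable fun a => F a (assignment (y a))
  clause : ∀ y (c : ι → Bool), M.PolyTime y → M.PolyDecidable (c · = true) →
    M.PolyDecidable fun a => F a (clause (y a) (c a))
  bucket : ∀ y (c : ι → Bool), M.PolyTime y → M.PolyDecidable (c · = true) →
    M.PolyDecidable fun a => F a (bucket (y a) (c a))
  hub : M.PolyDecidable fun a => F a hub

theorem VertexPolyDecidable.vertexAt {ι σ : Type*} {M : RAM.InputModel ι σ}
    {F : ι → Vertex ℕ ℕ ℕ ℕ ℕ → Prop} {l p q r b x : ι → ℕ} (h : VertexPolyDecidable M F)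
    (hl : M.PolyTime l) (hp : M.PolyTime p) (hq : M.PolyTime q) (hr : M.PolyTime r)
    (hb : M.PolyTime b) (hx : M.PolyTime x) :
    M.PolyDecidable fun a => F a (vertexAt (l a) (p a) (q a) (r a) (b a) (x a)) := by
  have odd {y : ι → ℕ} (hy : M.PolyTime y) : M.PolyDecidable fun a => decide (y a % 2 = 1) = true :=
    (PolyDecidable.eq (hy.mod (.const 2)) (.const 1)).congr fun _ => decide_eq_true_iff.symm
  have hx₁ := hx.sub ((PolyTime.const 2).mul hl)
  have hx₂ := hx₁.sub hp
  have hx₃ := hx₂.sub hq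
  have hx₄ := hx₃.sub ((PolyTime.const 2).mul hr)
  refine (PolyDecidable.ite (.lt hx ((PolyTime.const 2).mul hl))
    (h.forced _ _ (hx.div (.const 2)) (odd hx)) <|
    .ite (.lt hx₁ hp) (h.portal _ hx₁) <|
    .ite (.lt hx₂ hq) (h.assignment _ hx₂) <|
    .ite (.lt hx₃ ((PolyTime.const 2).mul hr)) (h.clause _ _ (hx₃.div (.const 2)) (odd hx₃)) <|
    .ite (.lt hx₄ ((PolyTime.const 2).mul hb)) (h.bucket _ _ (hx₄.div (.const 2)) (odd hx₄))
      h.hub).congr fun a => ?_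
  unfold Gadget.vertexAt
  split_ifs <;> rfl

end Gadget

namespace PartitionedSAT

open RAM.InputModel

/-- The vertex of the gadget graph that has the number `x` in `ψ.target.graph`. -/
def vertexAt (ψ : PartitionedSAT) (x : ℕ) : Gadget.Vertex ℕ ℕ ℕ ℕ ℕ :=
  Gadget.vertexAt (2 * (ψ.codeLength + 2)) (9 * ψ.side) (3 * ψ.side * 2 ^ ψ.side)
    ψ.clauses.length (3 * ψ.side) x

/-- The adjacency of `ψ.target.graph` in terms of the numbers of the vertices. -/
def Adj (ψ : PartitionedSAT) (x y : ℕ) : Prop :=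
  x ≠ y ∧ (ψ.numericGadget.Rel (ψ.vertexAt x) (ψ.vertexAt y) ∨
    ψ.numericGadget.Rel (ψ.vertexAt y) (ψ.vertexAt x))

theorem adj_iff_target_adj {ψ : PartitionedSAT} (u v : Fin ψ.target.numVerts) :
    ψ.Adj u v ↔ ψ.target.graph.Adj u v := by
  rw [Adj, ne_eq, ← Fin.ext_iff]
  rfl

open Classical in
theorem encode_target (ψ : PartitionedSAT) :
    ψ.target.encode = [ψ.target.k] ++ ([ψ.target.numVerts] ++
      (List.range ψ.target.numVerts).flatMap fun x =>
        (List.range ψ.target.numVerts).flatMap fun y => [if ψ.Adj x y then 1 else 0]) := by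
  simp only [← List.map_coe_finRange_eq_range, List.flatMap_map, adj_iff_target_adj]
  simp only [MetricDimensionInstance.encode, List.map_eq_flatMap, List.cons_append,
    List.nil_append]

namespace IsStored

variable {ι σ : Type*} {M : RAM.InputModel ι σ} {φ : ι → PartitionedSAT} {f d s p q r : ι → ℕ}

theorem push (h : IsStored M φ) : IsStored M.push fun a => φ a.1 :=
  ⟨fun a => h.mem_eq a.1, h.polyBounded.lift⟩

theorem cell (h : IsStored M φ) (hf : M.PolyTime f) : M.PolyTime fun a => (φ a).cell (f a) :=
  hf.load.congr fun a => h.mem_eq a _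

theorem clauses_length (h : IsStored M φ) : M.PolyTime fun a => (φ a).clauses.length :=
  h.cell (.const 1)

theorem side (h : IsStored M φ) : M.PolyTime fun a => (φ a).side :=
  (h.cell (.const 0)).sqrt.add (.const 1)

theorem codeLength (h : IsStored M φ) : M.PolyTime fun a => (φ a).codeLength :=
  (PolyTime.const 15).mul h.side

theorem two_pow_side (h : IsStored M φ) : M.PolyTime fun a => 2 ^ (φ a).side :=
  h.side.two_pow <| h.polyBounded.mono fun a =>
    Nat.pow_le_pow_right two_pos (Nat.le_mul_of_pos_left _ (by norm_num))

theorem clauseAddress (h : IsStored M φ) (hr : M.PolyTime r)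
    (hle : ∀ a, r a ≤ (φ a).clauses.length) : M.PolyTime fun a => (φ a).clauseAddress (r a) := by
  have hstep : M.push.PolyTime fun a => a.2 + 1 + 3 * (φ a.1).cell a.2 :=
    (PolyTime.snd.add (.const 1)).add ((PolyTime.const 3).mul (h.push.cell .snd))
  refine (hstep.iterate hr (.const 2) (((PolyBounded.const 10).mul
    h.clauses_length.polyBounded).add (.const 2)) fun a i hi => ?_).congr fun a =>
      iterate_eq_clauseAddress (hle a)
  have hi' := hi.trans (hle a)
  exact (iterate_eq_clauseAddress hi').trans_le ((clauseAddress_le hi').trans (by omega))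

theorem portalMeets (h : IsStored M φ) (hp : M.PolyTime p) (hq : M.PolyTime q) :
    M.PolyDecidable fun a => (φ a).PortalMeets (p a) (q a) := by
  classical
  have hq' := hq.div h.two_pow_side
  exact .ite (.lt hp ((PolyTime.const 3).mul h.side)) (.eq hp hq')
    ((PolyDecidable.eq ((hp.div h.side).mod (.const 3)) (hq'.div h.side)).and
      ((hq.testBit (hp.mod h.side)).iff (.eq (hp.div ((PolyTime.const 3).mul h.side)) (.const 1))))

theorem literalBlocks (h : IsStored M φ) (hd : M.PolyTime d) (hf : M.PolyTime f)
    (hs : M.PolyTime s) (hp : M.PolyTime p) :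
    M.PolyDecidable fun a => (φ a).LiteralBlocks (d a) (f a) (s a) (p a) := by
  have hb := h.side
  exact .ite (.lt hp ((PolyTime.const 3).mul hb)) (.eq hp ((hd.mul hb).add (hf.div hb)))
    ((PolyDecidable.eq ((hp.div hb).mod (.const 3)) hd).and
      ((PolyDecidable.eq (hp.mod hb) (hf.mod hb)).imp
        (PolyDecidable.eq (hp.div ((PolyTime.const 3).mul hb)) (hs.add (.const 1))).not))

theorem blocks (h : IsStored M φ) (hr : M.PolyTime r) (hp : M.PolyTime p) :
    M.PolyDecidable fun a => (φ a).numericGadget.Blocks (r a) (p a) := by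
  classical
  have hlt := PolyDecidable.lt hr h.clauses_length
  have haddr := h.clauseAddress (PolyTime.ite hlt hr (.const 0)) fun a => by split_ifs <;> omega
  refine (hlt.and (.exists_fin fun j : Fin 3 => (PolyDecidable.lt (.const j) (h.cell haddr)).and <|
    h.literalBlocks (h.cell (haddr.add (.const (1 + 3 * j))))
      (h.cell (haddr.add (.const (1 + 3 * j + 1)))) (h.cell (haddr.add (.const (1 + 3 * j + 2))))
      hp)).congr fun a => ?_
  rw [numericGadget_blocks_iff]
  refine and_congr_right fun hra => ?_
  rw [if_pos hra]

variable {F : ι → Gadget.Vertex ℕ ℕ ℕ ℕ ℕ → Prop} {x y z : ι → ℕ} {c : ι → Bool}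

theorem vertexAt (h : IsStored M φ) (hF : Gadget.VertexPolyDecidable M F) (hx : M.PolyTime x) :
    M.PolyDecidable fun a => F a ((φ a).vertexAt (x a)) :=
  hF.vertexAt ((PolyTime.const 2).mul (h.codeLength.add (.const 2)))
    ((PolyTime.const 9).mul h.side) (((PolyTime.const 3).mul h.side).mul h.two_pow_side)
    h.clauses_length ((PolyTime.const 3).mul h.side) hx

theorem mem_code (h : IsStored M φ) (hy : M.PolyTime y) :
    Gadget.VertexPolyDecidable M fun a v => y a ∈ (φ a).numericGadget.code v where
  forced _ _ hz _ := .eq hy hz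
  portal _ hz := polyDecidable_mem_codeword h.codeLength ((PolyTime.const 3).mul hz) hy 0
  assignment _ hz := polyDecidable_mem_codeword h.codeLength
    (((PolyTime.const 3).mul hz).add (.const 1)) hy 0
  clause _ _ hz _ := polyDecidable_mem_codeword h.codeLength hz hy 1
  bucket _ _ hz _ := polyDecidable_mem_codeword h.codeLength
    (((PolyTime.const 3).mul hz).add (.const 2)) hy 0
  hub := .const True

theorem rel_portal (h : IsStored M φ) (hz : M.PolyTime z) :
    Gadget.VertexPolyDecidable M fun a v => (φ a).numericGadget.Rel (.portal (z a)) v where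
  forced _ _ _ _ := .const False
  portal _ _ := .const False
  assignment _ hy := h.portalMeets hz hy
  clause _ _ hy hc := hc.or (h.blocks hy hz).not
  bucket _ _ _ _ := .const False
  hub := .const False

theorem rel_bucket (h : IsStored M φ) (hz : M.PolyTime z) (hc : M.PolyDecidable (c · = true)) :
    Gadget.VertexPolyDecidable M fun a v =>
      (φ a).numericGadget.Rel (.bucket (z a) (c a)) v where
  forced _ _ _ _ := .const False
  portal _ _ := .const False
  assignment _ hy := (hc.not.congr fun _ => Bool.not_eq_true _ ▸ Iff.rfl).and
    (.eq (hy.div h.two_pow_side) hz)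
  clause _ _ _ _ := .const False
  bucket _ _ _ _ := .const False
  hub := .const False

theorem rel_hub : Gadget.VertexPolyDecidable M fun a v => (φ a).numericGadget.Rel .hub v where
  forced _ _ _ _ := .const True
  portal _ _ := .const True
  assignment _ _ := .const False
  clause _ _ _ _ := .const True
  bucket _ _ _ _ := .const True
  hub := .const True

theorem rel_vertexAt (h : IsStored M φ) (hx : M.PolyTime x) :
    Gadget.VertexPolyDecidable M fun a u =>
      (φ a).numericGadget.Rel u ((φ a).vertexAt (x a)) where
  forced _ _ hz _ := h.vertexAt (h.mem_code hz) hx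
  portal _ hz := h.vertexAt (h.rel_portal hz) hx
  assignment _ _ := .const False
  clause _ _ _ _ := .const False
  bucket _ _ hz hc := h.vertexAt (h.rel_bucket hz hc) hx
  hub := h.vertexAt rel_hub hx

theorem rel (h : IsStored M φ) (hx : M.PolyTime x) (hy : M.PolyTime y) :
    M.PolyDecidable fun a =>
      (φ a).numericGadget.Rel ((φ a).vertexAt (x a)) ((φ a).vertexAt (y a)) :=
  h.vertexAt (F := fun a u => (φ a).numericGadget.Rel u ((φ a).vertexAt (y a)))
    (h.rel_vertexAt hy) hx

theorem numVerts (h : IsStored M φ) : M.PolyTime fun a => (φ a).target.numVerts :=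
  ((((((PolyTime.const 2).mul ((PolyTime.const 2).mul (h.codeLength.add (.const 2)))).add
    ((PolyTime.const 9).mul h.side)).add (((PolyTime.const 3).mul h.side).mul h.two_pow_side)).add
    ((PolyTime.const 2).mul h.clauses_length)).add
    ((PolyTime.const 2).mul ((PolyTime.const 3).mul h.side))).add (.const 1)

theorem k (h : IsStored M φ) : M.PolyTime fun a => (φ a).target.k :=
  ((PolyTime.const 2).mul (h.codeLength.add (.const 2))).add ((PolyTime.const 3).mul h.side)

theorem adj (h : IsStored M φ) (hx : M.PolyTime x) (hy : M.PolyTime y) :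
    M.PolyDecidable fun a => (φ a).Adj (x a) (y a) :=
  (PolyDecidable.eq hx hy).not.and ((h.rel hx hy).or (h.rel hy hx))

open Classical in
theorem encode_target (h : IsStored M φ) : M.PolyEmits fun a => (φ a).target.encode := by
  have hrow : M.push.push.PolyEmits fun a => [if (φ a.1.1).Adj a.1.2 a.2 then 1 else 0] :=
    .singleton (h.push.push.adj PolyTime.snd.lift .snd)
  simp only [PartitionedSAT.encode_target]
  exact (PolyEmits.singleton h.k).append <| (PolyEmits.singleton h.numVerts).append <|
    (hrow.flatMap_range h.numVerts.lift).flatMap_range h.numVerts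

end IsStored

theorem exists_outputsIn_encode_target :
    ∃ (p : RAM.Prog) (D : ℕ), ∀ ψ : PartitionedSAT,
      ∃ t ≤ (2 ^ ψ.codeLength + 2) ^ D, RAM.OutputsIn p ψ.encode ψ.target.encode t := by
  obtain ⟨p, T, ⟨D, hD⟩, hp⟩ := isStored_inputModel.encode_target Empty.elim 0 fun i => i.elim
  refine ⟨p, D, fun ψ => ?_⟩
  obtain ⟨s, t, hrun, hs, ht⟩ := hp ψ (RAM.start ψ.encode) ⟨fun i => i.elim, rfl⟩
  exact ⟨t, ht.trans (hD ψ), s, hrun, hs.out_eq⟩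

theorem side_le {ψ : PartitionedSAT} (hψ : 1 ≤ ψ.numVars) :
    (ψ.side : ℝ) ≤ 2 * √(ψ.numVars : ℝ) := by
  have hn : 1 ≤ ψ.n := by rw [numVars] at hψ; omega
  have hsqrt : (√(ψ.n : ℝ)) ≤ √(ψ.numVars : ℝ) :=
    Real.sqrt_le_sqrt (by exact_mod_cast Nat.le_mul_of_pos_left _ three_pos)
  have hone : 1 ≤ √(ψ.n : ℝ) := Real.one_le_sqrt.2 (by exact_mod_cast hn)
  have hfloor : (ψ.n.sqrt : ℝ) ≤ √(ψ.n : ℝ) := Real.nat_sqrt_le_real_sqrt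
  rw [side, Nat.cast_succ]
  linarith

theorem cast_le_two_rpow {ψ : PartitionedSAT} (hψ : 1 ≤ ψ.numVars) {t D : ℕ} {c : ℝ}
    (ht : t ≤ (2 ^ ψ.codeLength + 2) ^ D) (hc : 34 * D ≤ c) :
    (t : ℝ) ≤ 2 ^ (c * √(ψ.numVars : ℝ)) := by
  have hbase : 2 ^ ψ.codeLength + 2 ≤ 2 ^ (17 * ψ.side) := calc
    2 ^ ψ.codeLength + 2 ≤ 2 ^ ψ.codeLength * 2 ^ 2 := by
      have := Nat.one_le_two_pow (n := ψ.codeLength)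
      omega
    _ ≤ 2 ^ (17 * ψ.side) := by
      rw [← pow_add]
      have := ψ.side_pos
      exact Nat.pow_le_pow_right two_pos (by rw [codeLength]; omega)
  have hpow : t ≤ 2 ^ (17 * ψ.side * D) :=
    ht.trans ((Nat.pow_le_pow_left hbase D).trans_eq (pow_mul ..).symm)
  calc (t : ℝ) ≤ 2 ^ (17 * ψ.side * D) := by exact_mod_cast hpow
    _ = 2 ^ ((17 * ψ.side * D : ℕ) : ℝ) := (Real.rpow_natCast _ _).symm
    _ ≤ 2 ^ (c * √(ψ.numVars : ℝ)) := by
        push_cast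
        refine Real.rpow_le_rpow_of_exponent_le one_le_two ?_
        calc 17 * (ψ.side : ℝ) * D ≤ 17 * (2 * √(ψ.numVars : ℝ)) * D :=
              mul_le_mul_of_nonneg_right (mul_le_mul_of_nonneg_left (side_le hψ) (by norm_num))
                D.cast_nonneg
          _ = 34 * D * √(ψ.numVars : ℝ) := by ring
          _ ≤ c * √(ψ.numVars : ℝ) := mul_le_mul_of_nonneg_right hc (Real.sqrt_nonneg _)

end PartitionedSAT

theorem theorem3 :
    ∃ (p : RAM.Prog) (c : ℝ), ∀ ψ : PartitionedSAT, 1 ≤ ψ.numVars →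
      ∃ (I : MetricDimensionInstance) (t vc : ℕ),
        RAM.OutputsIn p ψ.encode I.encode t ∧
        (t : ℝ) ≤ 2 ^ (c * √(ψ.numVars : ℝ)) ∧
        (ψ.Satisfiable ↔ I.IsYes) ∧
        I.graph.vertexCoverNum = (vc : ℕ∞) ∧
        (vc : ℝ) + (I.k : ℝ) ≤ c * √(ψ.numVars : ℝ) ∧
        (I.numVerts : ℝ) ≤ 2 ^ (c * √(ψ.numVars : ℝ)) := by
  obtain ⟨p, D, hp⟩ := PartitionedSAT.exists_outputsIn_encode_target
  obtain ⟨E, hE⟩ := PartitionedSAT.isStored_inputModel.numVerts.polyBounded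
  have hD : (0 : ℝ) ≤ D := D.cast_nonneg
  have hE₀ : (0 : ℝ) ≤ E := E.cast_nonneg
  refine ⟨p, 34 * D + 34 * E + 242, fun ψ hψ => ?_⟩
  obtain ⟨t, ht, hout⟩ := hp ψ
  obtain ⟨vc, hvc, hsum⟩ := ψ.exists_vertexCoverNum_target_eq
  refine ⟨ψ.target, t, vc, hout, PartitionedSAT.cast_le_two_rpow hψ ht (by linarith [hE₀]),
    ψ.satisfiable_iff_isYes_target, hvc, ?_,
    PartitionedSAT.cast_le_two_rpow hψ (hE ψ) (by linarith [hD])⟩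
  have hside := PartitionedSAT.side_le hψ
  calc (vc : ℝ) + ψ.target.k ≤ 121 * ψ.side := by exact_mod_cast hsum
    _ ≤ 242 * √(ψ.numVars : ℝ) := by linarith
    _ ≤ _ := by gcongr; linarith [hD, hE₀]
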